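/- Let $n\ge 2$ and $0<a<b$, and let $T$ be the flat $n$-torus obtained from the rectangle $\{(x^1,\dots,x^n): 0\le x^j\le a\ (j\ne n),\ 0\le x^n\le b\}$ by gluing opposite faces, i.e. $T=\mathbb{R}^n/((a\mathbb{Z})^{n-1}\times b\mathbb{Z})$ with the flat metric. Let $\Delta=-\operatorname{div}\circ\operatorname{grad}$ be its Laplacian, $V(T)$ its volume and $\operatorname{inj}(T)$ its injectivity radius; thus $V(T)=a^{n-1}b$ and $\operatorname{inj}(T)=a/2$. Consider orthonormal bases $\varphi_0\equiv V(T)^{-1/2},\varphi_1,\varphi_2,\dots$ of the real space $L^2(T)$ consisting of smooth eigenfunctions of $\Delta$, listed by nondecreasing eigenvalue. The embedding dimension of $T$ is the smallest $m$ such that, for some choice of such a basis, the map $\Phi^m=(\varphi_1,\dots,\varphi_m):T\to\mathbb{R}^m$ is a smooth embedding (an immersion that is a homeomorphism onto its image). Then the embedding dimension of $T$ exists and equals $$d=2\bigl(\lceil b/a\rceil+n-2\bigr),\qquad\text{and}\qquad d\ \ge\ 2^{1-n}\,\frac{V(T)}{\operatorname{inj}(T)^n}.$$ -/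

import Mathlib

open MeasureTheory Set Topology
open scoped ContDiff Laplacian

noncomputable section

namespace FlatTorus

/-- The lattice of all vectors whose `j`-th coordinate is an integer multiple of `L j`. -/
def lattice {n : ℕ} (L : Fin n → ℝ) : AddSubgroup (EuclideanSpace ℝ (Fin n)) where
  carrier := {v | ∀ j, ∃ k : ℤ, v j = k * L j}
  zero_mem' := fun _ => ⟨0, by simp⟩
  add_mem' := by
    intro v w hv hw j
    obtain ⟨k, hk⟩ := hv j
    obtain ⟨l, hl⟩ := hw j
    exact ⟨k + l, by simp [hk, hl, add_mul]⟩
  neg_mem' := by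
    intro v hv j
    obtain ⟨k, hk⟩ := hv j
    exact ⟨-k, by simp [hk]⟩

/-- The flat torus with side lengths `L j`, i.e. the rectangle `∏ⱼ [0, L j]` with opposite faces
glued by translation. Its topology is the quotient topology, and its distance (Mathlib's quotient
norm) is `dist (π v) (π w) = inf_γ ‖v - w + γ‖` over the lattice vectors `γ`, which is the geodesic
distance of the flat metric. -/
abbrev Torus {n : ℕ} (L : Fin n → ℝ) : Type :=
  EuclideanSpace ℝ (Fin n) ⧸ lattice L

/-- The covering projection `π : ℝⁿ → T`. The smooth structure and the flat metric of `T` are the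
ones that make it a local isometry, so local notions on `T` are read off after lifting along it. -/
def proj {n : ℕ} (L : Fin n → ℝ) (v : EuclideanSpace ℝ (Fin n)) : Torus L :=
  QuotientAddGroup.mk v

/-- The glued rectangle, a fundamental domain. -/
def box {n : ℕ} (L : Fin n → ℝ) : Set (EuclideanSpace ℝ (Fin n)) :=
  {v | ∀ j, 0 ≤ v j ∧ v j ≤ L j}

/-- The Riemannian measure of the flat torus: Lebesgue measure of the rectangle. -/
def vol {n : ℕ} (L : Fin n → ℝ) : Measure (Torus L) :=
  (volume.restrict (box L)).map (proj L)

/-- The volume `V(T)`. -/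
def totalVolume {n : ℕ} (L : Fin n → ℝ) : ℝ := (vol L).real univ

/-- Smoothness, on an open set `U`, of a map from the torus to a normed space. -/
def SmoothOn {n : ℕ} {L : Fin n → ℝ} {F : Type*} [NormedAddCommGroup F] [NormedSpace ℝ F]
    (f : Torus L → F) (U : Set (Torus L)) : Prop :=
  ContDiffOn ℝ ∞ (f ∘ proj L) (proj L ⁻¹' U)

/-- Smoothness, on an open set `U`, of a map from `ℝⁿ` to the torus: it has smooth local lifts. -/
def SmoothOnInto {n : ℕ} {L : Fin n → ℝ} (h : EuclideanSpace ℝ (Fin n) → Torus L)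
    (U : Set (EuclideanSpace ℝ (Fin n))) : Prop :=
  ∀ v ∈ U, ∃ H : EuclideanSpace ℝ (Fin n) → EuclideanSpace ℝ (Fin n),
    ContDiffAt ℝ ∞ H v ∧ ∀ᶠ w in 𝓝 v, proj L (H w) = h w

theorem laplacian_comp_add_right {n : ℕ} (f : EuclideanSpace ℝ (Fin n) → ℝ)
    (c v : EuclideanSpace ℝ (Fin n)) : Δ (fun w => f (w + c)) v = Δ f (v + c) := by
  simp only [InnerProductSpace.laplacian_eq_iteratedFDeriv_stdOrthonormalBasis,
    iteratedFDeriv_comp_add_right]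

/-- The Laplacian `-div ∘ grad` of the flat torus, acting on (smooth) functions: minus the
Euclidean Laplacian of the lift, which is again periodic. -/
def laplacian {n : ℕ} {L : Fin n → ℝ} (f : Torus L → ℝ) (x : Torus L) : ℝ :=
  Quotient.liftOn' x (fun v => -Δ (f ∘ proj L) v) (by
    intro v w hvw
    have hmem : -v + w ∈ lattice L := QuotientAddGroup.leftRel_apply.mp hvw
    have hper : (fun u => (f ∘ proj L) (u + (-v + w))) = f ∘ proj L := by
      funext u
      simp only [Function.comp, proj]
      rw [QuotientAddGroup.mk_add_of_mem u hmem]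
    have h := laplacian_comp_add_right (f ∘ proj L) (-v + w) v
    rw [hper, add_neg_cancel_left] at h
    simp only [h])

theorem laplacian_proj {n : ℕ} {L : Fin n → ℝ} (f : Torus L → ℝ)
    (v : EuclideanSpace ℝ (Fin n)) : laplacian f (proj L v) = -Δ (f ∘ proj L) v := rfl

/-- `φ₀, φ₁, φ₂, …` is an orthonormal basis of `L²(T)` consisting of smooth real eigenfunctions of
the Laplacian, listed by nondecreasing eigenvalue, with `φ₀` the positive constant `V(T)^{-1/2}`. -/
structure IsEigenbasis {n : ℕ} {L : Fin n → ℝ} (φ : ℕ → Torus L → ℝ) : Prop where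
  smooth : ∀ j, SmoothOn (φ j) univ
  eigen : ∃ ev : ℕ → ℝ, Monotone ev ∧ ∀ j x, laplacian (φ j) x = ev j * φ j x
  basis : ∃ B : HilbertBasis ℕ ℝ (Lp ℝ 2 (vol L)), ∀ j, (B j : Torus L → ℝ) =ᵐ[vol L] φ j
  zero : ∀ x, φ 0 x = (Real.sqrt (totalVolume L))⁻¹

/-- The eigenfunction map `Φᵐ = (φ₁, …, φₘ) : T → ℝᵐ`. -/
def eigenMap {n : ℕ} {L : Fin n → ℝ} (φ : ℕ → Torus L → ℝ) (m : ℕ) (x : Torus L) :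
    EuclideanSpace ℝ (Fin m) :=
  WithLp.toLp 2 (fun i : Fin m => φ ((i : ℕ) + 1) x)

/-- Smooth embeddings of the torus in `ℝᵐ`: smooth immersions that are homeomorphisms onto their
image. -/
structure IsSmoothEmbedding {n m : ℕ} {L : Fin n → ℝ}
    (F : Torus L → EuclideanSpace ℝ (Fin m)) : Prop where
  smooth : SmoothOn F univ
  immersion : ∀ v, Function.Injective (fderiv ℝ (F ∘ proj L) v)
  embedding : IsEmbedding F

/-- `d` is the embedding dimension: the smallest `m` for which `Φᵐ` is a smooth embedding for some
choice of eigenbasis. -/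
def IsEmbeddingDimension {n : ℕ} (L : Fin n → ℝ) (d : ℕ) : Prop :=
  IsLeast {m : ℕ | ∃ φ : ℕ → Torus L → ℝ, IsEigenbasis φ ∧ IsSmoothEmbedding (eigenMap φ m)} d

/-- The exponential map at `x`: the geodesics of the flat torus are the projected straight lines. -/
def expMap {n : ℕ} {L : Fin n → ℝ} (x : Torus L) (v : EuclideanSpace ℝ (Fin n)) : Torus L :=
  x + proj L v

/-- `exp_x : B(r) → B(x, r)` is a diffeomorphism. -/
def IsExpDiffeo {n : ℕ} {L : Fin n → ℝ} (x : Torus L) (r : ℝ) : Prop :=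
  BijOn (expMap x) (Metric.ball 0 r) (Metric.ball x r) ∧
  SmoothOnInto (expMap x) (Metric.ball 0 r) ∧
  ∃ g : Torus L → EuclideanSpace ℝ (Fin n),
    InvOn g (expMap x) (Metric.ball 0 r) (Metric.ball x r) ∧ SmoothOn g (Metric.ball x r)

/-- `ρ` is the injectivity radius: the largest real number such that `exp_x : B(r) → B(x, r)` is a
diffeomorphism for all `x` and all `r ≤ ρ`. -/
def IsInjectivityRadius {n : ℕ} (L : Fin n → ℝ) (ρ : ℝ) : Prop :=
  IsGreatest {R : ℝ | ∀ x : Torus L, ∀ r ≤ R, IsExpDiffeo x r} ρ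

/-- The side lengths of the stretched torus: `a` in the first `n - 1` coordinates, `b` in the last
one. -/
def stretchedSides (n : ℕ) (a b : ℝ) : Fin n → ℝ :=
  fun j => if (j : ℕ) + 1 = n then b else a

end FlatTorus

end

/-! For each frequency vector `k` the Hartley function `cos θ + sin θ`, with `θ = phase L k`, is a
real eigenfunction, and after normalization these functions form an orthonormal basis of `L²`. Let
`λ = (2π/a)²` be the short eigenvalue and `K = ⌈b/a⌉ - 1`. Below `λ` lie only frequencies in the
long direction, `2K + 1` of them including zero. At `λ` lie the `2(n-1)` signed unit frequencies in
the short directions, and also `±b/a` in the long direction when `b/a` is an integer. Thus `d = 2K +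
2(n-1)`.

Upper bound (`exists_embedding_eigenbasis`): break ties at `λ` in favour of the unit frequencies.
Then `φ₁, …, φ_d` include the Hartley functions of all signed unit frequencies. These determine each
`exp(iθⱼ)` and its derivative, so the map is an injective immersion of a compact space.

Lower bound (`le_of_injective_eigenMap`): restrict an arbitrary eigenbasis to the slice where the
last coordinate vanishes, a product of `n-1` unit circles in `ℂⁿ⁻¹`. By
`IsEigenbasis.exists_expansion`, `φ₁, …, φ_{2K}` are constant there and the next functions, up to
index `d`, are real-affine. With `m < d`, at most `2(n-1) - 1` linear functionals matter on a real
space of dimension `2(n-1)`, so they share a kernel vector `u ≠ 0`. Scaled down, each coordinate of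
`u` is a difference of two unit complex numbers (`exists_exp_sub_exp_eq`), which gives two distinct
points with the same image.

The volume inequality reduces to `2b/a ≤ d`. -/

namespace FlatTorus

/-! ### Topology and measure of the flat torus. -/

variable {n : ℕ} {L : Fin n → ℝ}

theorem mem_lattice {v : EuclideanSpace ℝ (Fin n)} :
    v ∈ lattice L ↔ ∀ j, ∃ k : ℤ, v j = k * L j := Iff.rfl

theorem proj_eq_proj_iff {v w : EuclideanSpace ℝ (Fin n)} :
    proj L v = proj L w ↔ ∀ j, ∃ k : ℤ, w j - v j = k * L j := by
  rw [proj, proj, QuotientAddGroup.eq, mem_lattice]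
  simp [neg_add_eq_sub]

theorem proj_surjective : Function.Surjective (proj L) := QuotientAddGroup.mk_surjective

theorem continuous_proj : Continuous (proj L) := QuotientAddGroup.continuous_mk

theorem isQuotientMap_proj : IsQuotientMap (proj L) := QuotientAddGroup.isQuotientMap_mk _

theorem measurable_proj : Measurable (proj L) := QuotientAddGroup.measurable_coe

/-- Closedness makes the quotient Hausdorff; the Borel structure of `Torus L` rests on it. -/
theorem isClosed_lattice : IsClosed (lattice L : Set (EuclideanSpace ℝ (Fin n))) := by
  have h : (lattice L : Set (EuclideanSpace ℝ (Fin n)))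
      = ⋂ j, (fun v : EuclideanSpace ℝ (Fin n) => v j) ⁻¹' (AddSubgroup.zmultiples (L j)) := by
    ext v
    simp [mem_lattice, AddSubgroup.mem_zmultiples_iff, eq_comm]
  rw [h]
  refine isClosed_iInter fun j => IsClosed.preimage (by fun_prop) ?_
  exact AddSubgroup.isClosed_of_discrete

instance : IsClosed (lattice L : Set (EuclideanSpace ℝ (Fin n))) := isClosed_lattice

instance : BorelSpace (Torus L) := QuotientAddGroup.borelSpace

theorem box_eq_preimage (L : Fin n → ℝ) :
    box L = WithLp.ofLp ⁻¹' (Icc 0 L) := by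
  ext v
  simp [box, Pi.le_def, forall_and]

theorem isCompact_box (L : Fin n → ℝ) : IsCompact (box L) := by
  have h : box L = (EuclideanSpace.equiv (Fin n) ℝ).toHomeomorph ⁻¹' (Icc 0 L) := by
    ext v
    simp [box, Pi.le_def, forall_and]
  rw [h, Homeomorph.isCompact_preimage]
  exact isCompact_Icc

theorem exists_mem_box (hL : ∀ j, 0 < L j) (x : Torus L) : ∃ v ∈ box L, proj L v = x := by
  obtain ⟨w, rfl⟩ := proj_surjective x
  refine ⟨WithLp.toLp 2 fun j => w j - ⌊w j / L j⌋ * L j, fun j => ?_, ?_⟩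
  · have h1 := Int.floor_le (w j / L j)
    have h2 := (Int.lt_floor_add_one (w j / L j)).le
    rw [le_div_iff₀ (hL j)] at h1
    rw [div_le_iff₀ (hL j)] at h2
    constructor <;> simp only <;> linarith
  · rw [proj_eq_proj_iff]
    exact fun j => ⟨⌊w j / L j⌋, by simp⟩

theorem compactSpace (hL : ∀ j, 0 < L j) : CompactSpace (Torus L) := by
  refine ⟨?_⟩
  have h : (univ : Set (Torus L)) = proj L '' box L := by
    ext x
    simpa using exists_mem_box hL x
  rw [h]
  exact (isCompact_box L).image continuous_proj

theorem volume_box (hL : ∀ j, 0 < L j) : volume (box L) = ENNReal.ofReal (∏ j, L j) := by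
  rw [box_eq_preimage,
    (PiLp.volume_preserving_ofLp (Fin n)).measure_preimage
      measurableSet_Icc.nullMeasurableSet, Real.volume_Icc_pi,
    ENNReal.ofReal_prod_of_nonneg fun j _ => (hL j).le]
  simp

theorem vol_univ (hL : ∀ j, 0 < L j) : vol L univ = ENNReal.ofReal (∏ j, L j) := by
  rw [vol, Measure.map_apply measurable_proj MeasurableSet.univ]
  simp [volume_box hL]

theorem totalVolume_eq (hL : ∀ j, 0 < L j) : totalVolume L = ∏ j, L j := by
  rw [totalVolume, Measure.real, vol_univ hL,
    ENNReal.toReal_ofReal (Finset.prod_nonneg fun j _ => (hL j).le)]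

theorem totalVolume_pos (hL : ∀ j, 0 < L j) : 0 < totalVolume L := by
  rw [totalVolume_eq hL]
  exact Finset.prod_pos fun j _ => hL j

instance : IsFiniteMeasure (vol L) := by
  have : IsFiniteMeasure (volume.restrict (box L)) :=
    ⟨by simpa using (isCompact_box L).measure_lt_top⟩
  unfold vol
  infer_instance

theorem integral_vol {f : Torus L → ℝ} (hf : Continuous f) :
    ∫ x, f x ∂vol L = ∫ v in box L, f (proj L v) := by
  rw [vol, integral_map measurable_proj.aemeasurable hf.aestronglyMeasurable]

theorem convex_box (L : Fin n → ℝ) : Convex ℝ (box L) := by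
  intro v hv w hw s t hs ht hst j
  have h1 := hv j
  have h2 := hw j
  simp only [PiLp.add_apply, PiLp.smul_apply, smul_eq_mul]
  constructor
  · exact add_nonneg (mul_nonneg hs h1.1) (mul_nonneg ht h2.1)
  · calc s * v j + t * w j ≤ s * L j + t * L j := by gcongr <;> tauto
      _ = L j := by rw [← add_mul, hst, one_mul]

theorem interior_box_nonempty (hL : ∀ j, 0 < L j) : (interior (box L)).Nonempty := by
  have ho : IsOpen {v : EuclideanSpace ℝ (Fin n) | ∀ j, 0 < v j ∧ v j < L j} := by
    simp only [ofPred_forall]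
    refine isOpen_iInter_of_finite fun j => ?_
    have hj : Continuous fun v : EuclideanSpace ℝ (Fin n) => v j := by fun_prop
    exact (isOpen_lt continuous_const hj).inter (isOpen_lt hj continuous_const)
  refine ⟨WithLp.toLp 2 fun j => L j / 2, interior_maximal ?_ ho ?_⟩
  · exact fun v hv j => ⟨(hv j).1.le, (hv j).2.le⟩
  · intro j
    have := hL j
    constructor <;> simp only <;> linarith

/-- A lift may fall on the boundary of the box, but the box is convex with nonempty interior, so its
interior is dense in it. This later upgrades almost-everywhere equality of continuous functions to
equality. -/
theorem isOpenPosMeasure_vol (hL : ∀ j, 0 < L j) : (vol L).IsOpenPosMeasure := by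
  refine ⟨fun U hU hne => ?_⟩
  obtain ⟨x, hx⟩ := hne
  obtain ⟨v, hv, rfl⟩ := exists_mem_box hL x
  have hpre : IsOpen (proj L ⁻¹' U) := hU.preimage continuous_proj
  have hcl : v ∈ closure (interior (box L)) := by
    rw [(convex_box L).closure_interior_eq_closure_of_nonempty_interior (interior_box_nonempty hL)]
    exact subset_closure hv
  have hne := mem_closure_iff.1 hcl _ hpre hx
  rw [vol, Measure.map_apply measurable_proj hU.measurableSet,
    Measure.restrict_apply (measurable_proj hU.measurableSet)]
  refine ((hpre.inter isOpen_interior).measure_pos volume hne).ne' ∘ fun h => ?_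
  exact measure_mono_null (inter_subset_inter_right _ interior_subset) h

theorem SmoothOn.contDiff {F : Type*} [NormedAddCommGroup F] [NormedSpace ℝ F] {f : Torus L → F}
    (hf : SmoothOn f univ) : ContDiff ℝ ∞ (f ∘ proj L) :=
  contDiffOn_univ.1 hf

theorem SmoothOn.continuous {F : Type*} [NormedAddCommGroup F] [NormedSpace ℝ F] {f : Torus L → F}
    (hf : SmoothOn f univ) : Continuous f :=
  isQuotientMap_proj.continuous_iff.2 hf.contDiff.continuous

end FlatTorus

/-! ### Divergence theorem and orthogonality of eigenfunctions. -/

namespace FlatTorus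

theorem setIntegral_box {n : ℕ} (L : Fin n → ℝ) (h : EuclideanSpace ℝ (Fin n) → ℝ) :
    ∫ v in box L, h v = ∫ u in Icc 0 L, h (WithLp.toLp 2 u) := by
  rw [box_eq_preimage, ← (PiLp.volume_preserving_ofLp (Fin n)).setIntegral_preimage_emb
    (MeasurableEquiv.toLp 2 (Fin n → ℝ)).symm.measurableEmbedding]

theorem single_mem_lattice {n : ℕ} (L : Fin n → ℝ) (i : Fin n) :
    EuclideanSpace.single i (L i) ∈ lattice L := by
  intro j
  by_cases hj : j = i
  · exact ⟨1, by simp [hj]⟩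
  · exact ⟨0, by simp [hj]⟩

/-- The divergence theorem on the torus: the integral of a divergence vanishes. -/
theorem integral_divergence_eq_zero {m : ℕ} {L : Fin (m + 1) → ℝ} (hL : ∀ j, 0 < L j)
    (F : Fin (m + 1) → EuclideanSpace ℝ (Fin (m + 1)) → ℝ) (hF : ∀ i, ContDiff ℝ 1 (F i))
    (hper : ∀ i, ∀ γ ∈ lattice L, ∀ v, F i (v + γ) = F i v) :
    ∫ v in box L, ∑ i, fderiv ℝ (F i) v (EuclideanSpace.single i 1) = 0 := by
  rw [setIntegral_box]
  let e : (Fin (m + 1) → ℝ) →L[ℝ] EuclideanSpace ℝ (Fin (m + 1)) :=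
    (EuclideanSpace.equiv (Fin (m + 1)) ℝ).symm.toContinuousLinearMap
  have he : ∀ u, e u = WithLp.toLp 2 u := fun u => rfl
  have hsing : ∀ i : Fin (m + 1), e (Pi.single i 1) = EuclideanSpace.single i 1 := fun i => rfl
  have hd : ∀ i u, HasFDerivAt (fun u => F i (e u)) ((fderiv ℝ (F i) (e u)).comp e) u := by
    intro i u
    exact (((hF i).differentiable one_ne_zero) (e u)).hasFDerivAt.comp u e.hasFDerivAt
  have hcont : Continuous fun u : Fin (m + 1) → ℝ =>
      ∑ i, ((fderiv ℝ (F i) (e u)).comp e) (Pi.single i 1) := by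
    simp only [ContinuousLinearMap.comp_apply]
    refine continuous_finsetSum _ fun i _ => ?_
    exact (((hF i).continuous_fderiv one_ne_zero).comp e.continuous).clm_apply continuous_const
  have key := integral_divergence_of_hasFDerivAt_off_countable' (a := (0 : Fin (m + 1) → ℝ))
    (b := L) (fun j => (hL j).le) (fun i u => F i (e u))
    (fun i u => (fderiv ℝ (F i) (e u)).comp e) ∅ countable_empty
    (fun i => ((hF i).continuous.comp e.continuous).continuousOn)
    (fun x _ i => hd i x) (hcont.integrableOn_Icc)
  refine Eq.trans ?_ (key.trans ?_)
  · rfl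
  -- Opposite faces differ by a lattice vector, so their flux integrals cancel.
  · refine Finset.sum_eq_zero fun i _ => ?_
    rw [sub_eq_zero]
    refine integral_congr_ae (Filter.Eventually.of_forall fun x => ?_)
    have : e (i.insertNth (L i) x) = e (i.insertNth 0 x) + EuclideanSpace.single i (L i) := by
      ext j
      refine Fin.succAboveCases i ?_ (fun j => ?_) j
      · simp [he]
      · simp [he]
    simp only [this, hper i _ (single_mem_lattice L i), Pi.zero_apply]

theorem laplacian_eq_sum {n : ℕ} (f : EuclideanSpace ℝ (Fin n) → ℝ) (v) :
    Δ f v = ∑ i, fderiv ℝ (fderiv ℝ f) v (EuclideanSpace.single i 1)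
      (EuclideanSpace.single i 1) := by
  rw [InnerProductSpace.laplacian_eq_iteratedFDeriv_orthonormalBasis f
    (EuclideanSpace.basisFun (Fin n) ℝ)]
  simp [iteratedFDeriv_two_apply]

theorem proj_add_of_mem {n : ℕ} {L : Fin n → ℝ} {γ : EuclideanSpace ℝ (Fin n)}
    (hγ : γ ∈ lattice L) (v) : proj L (v + γ) = proj L v :=
  QuotientAddGroup.mk_add_of_mem v hγ

theorem fderiv_add_of_mem {n : ℕ} {L : Fin n → ℝ} {γ : EuclideanSpace ℝ (Fin n)}
    (hγ : γ ∈ lattice L) (f : Torus L → ℝ) (v) :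
    fderiv ℝ (f ∘ proj L) (v + γ) = fderiv ℝ (f ∘ proj L) v := by
  rw [← fderiv_comp_add_right]
  congr 1
  funext w
  simp [proj_add_of_mem hγ]

/-- Smooth eigenfunctions of the Laplacian for different eigenvalues are orthogonal. -/
theorem integral_mul_eq_zero_of_eigen {m : ℕ} {L : Fin (m + 1) → ℝ} (hL : ∀ j, 0 < L j)
    {f g : Torus L → ℝ} (hf : SmoothOn f univ) (hg : SmoothOn g univ) {μ ν : ℝ}
    (hfe : ∀ x, laplacian f x = μ * f x) (hge : ∀ x, laplacian g x = ν * g x) (hμν : μ ≠ ν) :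
    ∫ x, f x * g x ∂vol L = 0 := by
  rw [integral_vol (f := fun x => f x * g x) (hf.continuous.mul hg.continuous)]
  set f' := f ∘ proj L with hf'
  set g' := g ∘ proj L with hg'
  have hfc : ContDiff ℝ ∞ f' := hf.contDiff
  have hgc : ContDiff ℝ ∞ g' := hg.contDiff
  have hfd : ContDiff ℝ 1 (fderiv ℝ f') := hfc.fderiv_right (by norm_cast)
  have hgd : ContDiff ℝ 1 (fderiv ℝ g') := hgc.fderiv_right (by norm_cast)
  have hfc1 : ContDiff ℝ 1 f' := hfc.of_le (by norm_cast)
  have hgc1 : ContDiff ℝ 1 g' := hgc.of_le (by norm_cast)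
  let s : Fin (m + 1) → EuclideanSpace ℝ (Fin (m + 1)) := fun i => EuclideanSpace.single i 1
  -- Green's identity: the field `f∇g - g∇f` has divergence `fΔg - gΔf = (μ - ν) f g`.
  have key := integral_divergence_eq_zero hL
    (fun i v => f' v * fderiv ℝ g' v (s i) - g' v * fderiv ℝ f' v (s i))
    (fun i => (hfc1.mul (hgd.clm_apply contDiff_const)).sub
      (hgc1.mul (hfd.clm_apply contDiff_const)))
    (fun i γ hγ v => by
      simp only [hf', hg', fderiv_add_of_mem hγ, Function.comp, proj_add_of_mem hγ])
  have hpt : ∀ v, ∑ i, fderiv ℝ (fun v => f' v * fderiv ℝ g' v (s i) - g' v * fderiv ℝ f' v (s i))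
      v (EuclideanSpace.single i 1) = (μ - ν) * (f' v * g' v) := by
    intro v
    have h1 := hfe (proj L v)
    have h2 := hge (proj L v)
    rw [laplacian_proj, laplacian_eq_sum] at h1 h2
    have hterm : ∀ i, fderiv ℝ (fun v => f' v * fderiv ℝ g' v (s i) - g' v * fderiv ℝ f' v (s i))
      v (s i) = f' v * fderiv ℝ (fderiv ℝ g') v (s i) (s i)
        - g' v * fderiv ℝ (fderiv ℝ f') v (s i) (s i) := by
      intro i
      have a1 := (hfc1.differentiable one_ne_zero v).hasFDerivAt
      have a2 := (hgc1.differentiable one_ne_zero v).hasFDerivAt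
      have b1 := ((hfd.differentiable one_ne_zero v).hasFDerivAt).clm_apply
        (hasFDerivAt_const (s i) v)
      have b2 := ((hgd.differentiable one_ne_zero v).hasFDerivAt).clm_apply
        (hasFDerivAt_const (s i) v)
      have hd : HasFDerivAt
          (fun v => f' v * fderiv ℝ g' v (s i) - g' v * fderiv ℝ f' v (s i)) _ v :=
        (a1.mul b2).sub (a2.mul b1)
      rw [hd.fderiv]
      simp
      ring
    have h3 : ∑ i, fderiv ℝ (fderiv ℝ f') v (s i) (s i) = - (μ * f' v) := by
      rw [← neg_eq_iff_eq_neg]; exact h1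
    have h4 : ∑ i, fderiv ℝ (fderiv ℝ g') v (s i) (s i) = - (ν * g' v) := by
      rw [← neg_eq_iff_eq_neg]; exact h2
    refine (Finset.sum_congr rfl fun i _ => hterm i).trans ?_
    rw [Finset.sum_sub_distrib, ← Finset.mul_sum, ← Finset.mul_sum, h3, h4]
    ring
  rw [integral_congr_ae (Filter.Eventually.of_forall hpt), integral_const_mul] at key
  exact (mul_eq_zero.1 key).resolve_left (sub_ne_zero.2 hμν)

end FlatTorus

namespace FlatTorus

/-! ### Hartley functions and their eigenvalues. -/

section Hartley

variable {n : ℕ} {L : Fin n → ℝ}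

/-- The phase `2π ∑ⱼ kⱼ vⱼ / Lⱼ` of the character of the torus with frequency vector `k`. -/
noncomputable def phase (L : Fin n → ℝ) (k : Fin n → ℤ) : EuclideanSpace ℝ (Fin n) →L[ℝ] ℝ :=
  ∑ j, (2 * Real.pi * k j / L j) • EuclideanSpace.proj j

theorem phase_apply (k : Fin n → ℤ) (v) : phase L k v = ∑ j, 2 * Real.pi * k j / L j * v j := by
  simp [phase]

theorem phase_add (k l : Fin n → ℤ) (v) : phase L (k + l) v = phase L k v + phase L l v := by
  simp only [phase_apply, ← Finset.sum_add_distrib]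
  refine Finset.sum_congr rfl fun j _ => ?_
  simp
  ring

theorem phase_neg (k : Fin n → ℤ) (v) : phase L (-k) v = -phase L k v := by
  simp only [phase_apply, ← Finset.sum_neg_distrib]
  refine Finset.sum_congr rfl fun j _ => ?_
  simp
  ring

theorem phase_sub (k l : Fin n → ℤ) (v) : phase L (k - l) v = phase L k v - phase L l v := by
  rw [sub_eq_add_neg, phase_add, phase_neg, sub_eq_add_neg]

theorem phase_zero (v) : phase L 0 v = 0 := by simp [phase_apply]

theorem phase_single (j : Fin n) (c : ℤ) (v) :
    phase L (Pi.single j c) v = 2 * Real.pi * c / L j * v j := by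
  rw [phase_apply, Finset.sum_eq_single j]
  · simp
  · intro i _ hij
    simp [hij]
  · simp

theorem phase_mem_lattice (hL : ∀ j, 0 < L j) (k : Fin n → ℤ) {γ} (hγ : γ ∈ lattice L) :
    ∃ z : ℤ, phase L k γ = z * (2 * Real.pi) := by
  choose c hc using mem_lattice.1 hγ
  refine ⟨∑ j, k j * c j, ?_⟩
  rw [phase_apply]
  push_cast
  rw [Finset.sum_mul]
  refine Finset.sum_congr rfl fun j _ => ?_
  rw [hc j]
  have := (hL j).ne'
  field_simp

/-- The real eigenfunction `cos θ + sin θ`, where `θ` is the phase with frequency vector `k`. -/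
noncomputable def hartley (L : Fin n → ℝ) (k : Fin n → ℤ) (x : Torus L) : ℝ :=
  Real.cos (phase L k x.out) + Real.sin (phase L k x.out)

/-- The eigenvalue of `hartley L k`. -/
noncomputable def eigenvalue (L : Fin n → ℝ) (k : Fin n → ℤ) : ℝ :=
  ∑ j, (2 * Real.pi * k j / L j) ^ 2

/-- Two lifts of a point differ by a lattice vector, which shifts the phase by a multiple of `2π`;
hence the choice `x.out` is immaterial. -/
theorem hartley_proj (hL : ∀ j, 0 < L j) (k : Fin n → ℤ) (v) :
    hartley L k (proj L v) = Real.cos (phase L k v) + Real.sin (phase L k v) := by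
  have h : proj L (proj L v).out = proj L v := Quotient.out_eq _
  obtain ⟨z, hz⟩ := phase_mem_lattice hL k (QuotientAddGroup.eq.1 h.symm)
  have : phase L k (proj L v).out = phase L k v + z * (2 * Real.pi) := by
    rw [← hz, map_add, map_neg]; ring
  rw [hartley, this, Real.cos_add_int_mul_two_pi, Real.sin_add_int_mul_two_pi]

theorem hartley_comp_proj (hL : ∀ j, 0 < L j) (k : Fin n → ℤ) :
    hartley L k ∘ proj L = fun v => Real.cos (phase L k v) + Real.sin (phase L k v) :=
  funext fun v => hartley_proj hL k v

theorem smoothOn_hartley (hL : ∀ j, 0 < L j) (k : Fin n → ℤ) : SmoothOn (hartley L k) univ := by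
  rw [SmoothOn, hartley_comp_proj hL]
  exact ((Real.contDiff_cos.comp (phase L k).contDiff).add
    (Real.contDiff_sin.comp (phase L k).contDiff)).contDiffOn

theorem continuous_hartley (hL : ∀ j, 0 < L j) (k : Fin n → ℤ) : Continuous (hartley L k) :=
  (smoothOn_hartley hL k).continuous

theorem hasFDerivAt_hartley (hL : ∀ j, 0 < L j) (k : Fin n → ℤ) (v) :
    HasFDerivAt (hartley L k ∘ proj L)
      ((Real.cos (phase L k v) - Real.sin (phase L k v)) • phase L k) v := by
  rw [hartley_comp_proj hL]
  have h := (phase L k).hasFDerivAt (x := v)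
  refine ((h.cos).add h.sin).congr_fderiv ?_
  ext w
  simp
  ring

theorem laplacian_hartley (hL : ∀ j, 0 < L j) (k : Fin n → ℤ) (x : Torus L) :
    laplacian (hartley L k) x = eigenvalue L k * hartley L k x := by
  obtain ⟨v, rfl⟩ := proj_surjective x
  have h1 : fderiv ℝ (hartley L k ∘ proj L)
      = fun v => (Real.cos (phase L k v) - Real.sin (phase L k v)) • phase L k :=
    funext fun v => (hasFDerivAt_hartley hL k v).fderiv
  have h := (phase L k).hasFDerivAt (x := v)
  have h2 : HasFDerivAt (fun v => (Real.cos (phase L k v) - Real.sin (phase L k v)) • phase L k) _ v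
    := (h.cos.sub h.sin).smul_const (phase L k)
  rw [laplacian_proj, laplacian_eq_sum, h1, h2.fderiv, hartley_proj hL, eigenvalue,
    ← Finset.sum_neg_distrib, Finset.sum_mul]
  refine Finset.sum_congr rfl fun i _ => ?_
  have hs : phase L k (EuclideanSpace.single i 1) = 2 * Real.pi * k i / L i := by
    rw [phase_apply, Finset.sum_eq_single i]
    · simp
    · intro j _ hij
      simp [hij]
    · simp
  simp [hs]
  ring

theorem hartley_zero (hL : ∀ j, 0 < L j) (x : Torus L) : hartley L 0 x = 1 := by
  obtain ⟨v, rfl⟩ := proj_surjective x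
  simp [hartley_proj hL, phase_zero]

/-- This makes the span of the Hartley functions an algebra and reduces their inner products to
integrals of single ones. -/
theorem hartley_mul (hL : ∀ j, 0 < L j) (k l : Fin n → ℤ) (x : Torus L) :
    hartley L k x * hartley L l x = 1 / 2 * (hartley L (k - l) x + hartley L (l - k) x)
      + 1 / 2 * (hartley L (k + l) x - hartley L (-(k + l)) x) := by
  obtain ⟨v, rfl⟩ := proj_surjective x
  simp only [hartley_proj hL, phase_sub, phase_add, phase_neg, Real.cos_sub, Real.sin_sub,
    Real.cos_neg, Real.sin_neg, Real.cos_add, Real.sin_add]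
  ring

theorem eigenvalue_nonneg (k : Fin n → ℤ) : 0 ≤ eigenvalue L k :=
  Finset.sum_nonneg fun _ _ => sq_nonneg _

theorem eigenvalue_neg (k : Fin n → ℤ) : eigenvalue L (-k) = eigenvalue L k := by
  simp [eigenvalue, neg_div]

theorem eigenvalue_eq_zero_iff (hL : ∀ j, 0 < L j) (k : Fin n → ℤ) :
    eigenvalue L k = 0 ↔ k = 0 := by
  rw [eigenvalue, Finset.sum_eq_zero_iff_of_nonneg fun _ _ => sq_nonneg _, funext_iff]
  refine forall_congr' fun j => ?_
  simp [Real.pi_ne_zero, (hL j).ne']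

theorem finite_eigenvalue_le (hL : ∀ j, 0 < L j) (t : ℝ) : {k | eigenvalue L k ≤ t}.Finite := by
  have hfin :
      (Set.univ.pi fun j => {z : ℤ | |(z : ℝ)| ≤ (t + 1) * (L j / (2 * Real.pi))}).Finite := by
    refine Set.Finite.pi fun j => ?_
    refine (Set.finite_Icc (-⌈(t + 1) * (L j / (2 * Real.pi))⌉)
      ⌈(t + 1) * (L j / (2 * Real.pi))⌉).subset fun z hz => ?_
    have hz : |(z : ℝ)| ≤ (t + 1) * (L j / (2 * Real.pi)) := hz
    have h := abs_le.1 (hz.trans (Int.le_ceil _))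
    exact ⟨by exact_mod_cast h.1, by exact_mod_cast h.2⟩
  refine hfin.subset fun k hk j _ => ?_
  have hpos : 0 < L j / (2 * Real.pi) := div_pos (hL j) (by positivity)
  have h1 : (2 * Real.pi * k j / L j) ^ 2 ≤ t :=
    le_trans (Finset.single_le_sum (f := fun j => (2 * Real.pi * k j / L j) ^ 2)
      (fun _ _ => sq_nonneg _) (Finset.mem_univ j)) hk
  -- Crude bound without square roots: `|s| ≤ s² + 1`.
  have h2 : |2 * Real.pi * k j / L j| ≤ t + 1 := by
    rw [abs_le]
    constructor <;> nlinarith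
  have h3 : (k j : ℝ) = 2 * Real.pi * k j / L j * (L j / (2 * Real.pi)) := by
    have := (hL j).ne'
    have := Real.pi_ne_zero
    field_simp
  change |(k j : ℝ)| ≤ _
  rw [h3, abs_mul, abs_of_pos hpos]
  exact mul_le_mul_of_nonneg_right h2 hpos.le

/-- The frequencies `k` and `-k` give `cos θ + sin θ` and `cos θ - sin θ`, from which both terms are
recovered. -/
theorem cos_sin_eq_of_hartley_eq (hL : ∀ j, 0 < L j) {k : Fin n → ℤ} {v w}
    (h1 : hartley L k (proj L v) = hartley L k (proj L w))
    (h2 : hartley L (-k) (proj L v) = hartley L (-k) (proj L w)) :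
    Real.cos (phase L k v) = Real.cos (phase L k w) ∧
      Real.sin (phase L k v) = Real.sin (phase L k w) := by
  simp only [hartley_proj hL, phase_neg, Real.cos_neg, Real.sin_neg] at h1 h2
  constructor <;> linarith

/-- The Hartley functions whose frequency vectors are `±` unit vectors separate points. -/
theorem eq_of_hartley_eq (hL : ∀ j, 0 < L j) {x y : Torus L}
    (h : ∀ j, hartley L (Pi.single j 1) x = hartley L (Pi.single j 1) y ∧
      hartley L (-Pi.single j 1) x = hartley L (-Pi.single j 1) y) : x = y := by
  obtain ⟨v, rfl⟩ := proj_surjective x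
  obtain ⟨w, rfl⟩ := proj_surjective y
  rw [proj_eq_proj_iff]
  intro j
  obtain ⟨hc, hs⟩ := cos_sin_eq_of_hartley_eq hL (h j).1 (h j).2
  have ha := Real.Angle.cos_sin_inj hc.symm hs.symm
  obtain ⟨z, hz⟩ := Real.Angle.angle_eq_iff_two_pi_dvd_sub.1 ha
  rw [phase_single, phase_single] at hz
  refine ⟨z, ?_⟩
  have := (hL j).ne'
  have := Real.pi_ne_zero
  field_simp at hz
  push_cast at hz
  linarith

end Hartley

/-! ### Orthonormality and completeness of the Hartley functions in `L²`. -/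

section L2

variable {m : ℕ} {L : Fin (m + 1) → ℝ}

theorem integral_hartley (hL : ∀ j, 0 < L j) (k : Fin (m + 1) → ℤ) :
    ∫ x, hartley L k x ∂vol L = if k = 0 then totalVolume L else 0 := by
  split_ifs with hk
  · simp [hk, hartley_zero hL, totalVolume]
  · have h := integral_mul_eq_zero_of_eigen hL (smoothOn_hartley hL k) (smoothOn_hartley hL 0)
      (laplacian_hartley hL k) (laplacian_hartley hL 0) (by
        rw [(eigenvalue_eq_zero_iff hL 0).2 rfl]
        exact fun h => hk ((eigenvalue_eq_zero_iff hL k).1 h))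
    simpa [hartley_zero hL] using h

theorem integrable_of_continuous (hL : ∀ j, 0 < L j) {f : Torus L → ℝ} (hf : Continuous f) :
    Integrable f (vol L) := by
  have := compactSpace hL
  exact hf.integrable_of_hasCompactSupport (HasCompactSupport.of_compactSpace f)

theorem integral_hartley_mul (hL : ∀ j, 0 < L j) (k l : Fin (m + 1) → ℤ) :
    ∫ x, hartley L k x * hartley L l x ∂vol L = if k = l then totalVolume L else 0 := by
  have hi : ∀ k, Integrable (hartley L k) (vol L) := fun k =>
    integrable_of_continuous hL (continuous_hartley hL k)
  simp only [hartley_mul hL]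
  have h1 : Integrable (fun x => 1 / 2 * (hartley L (k - l) x + hartley L (l - k) x)) (vol L) :=
    ((hi _).add (hi _)).const_mul _
  have h2 : Integrable (fun x => 1 / 2 * (hartley L (k + l) x - hartley L (-(k + l)) x)) (vol L) :=
    ((hi _).sub (hi _)).const_mul _
  rw [integral_add h1 h2, integral_const_mul, integral_const_mul, integral_add (hi _) (hi _),
    integral_sub (hi _) (hi _)]
  -- The terms for `k + l` and `-(k + l)` cancel even when `k + l = 0`; those for `k - l` and `l -
  -- k` each give half the volume when `k = l`.
  simp only [integral_hartley hL, sub_eq_zero, neg_eq_zero, eq_comm (a := l)]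
  ring

theorem inner_eq_integral {F G : Lp ℝ 2 (vol L)} {f g : Torus L → ℝ}
    (hF : F =ᵐ[vol L] f) (hG : G =ᵐ[vol L] g) : inner ℝ F G = ∫ x, f x * g x ∂vol L := by
  rw [L2.inner_def]
  refine integral_congr_ae ?_
  filter_upwards [hF, hG] with x hx hy
  simp [hx, hy, mul_comm]

/-- The Hartley functions as bundled continuous functions. -/
noncomputable def hartleyC (hL : ∀ j, 0 < L j) (k : Fin (m + 1) → ℤ) : C(Torus L, ℝ) :=
  ⟨hartley L k, continuous_hartley hL k⟩

/-- Stone–Weierstrass: the span is a unital algebra that separates points. -/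
theorem span_hartleyC_closure_eq_top (hL : ∀ j, 0 < L j) [CompactSpace (Torus L)] :
    (Submodule.span ℝ (range (hartleyC hL))).topologicalClosure = ⊤ := by
  set p := Submodule.span ℝ (range (hartleyC hL)) with hp
  have hmem : ∀ k, hartleyC hL k ∈ p := fun k => Submodule.subset_span ⟨k, rfl⟩
  have h1 : (1 : C(Torus L, ℝ)) ∈ p := by
    have : hartleyC hL 0 = 1 := by
      ext x
      exact hartley_zero hL x
    exact this ▸ hmem 0
  have hmul : ∀ f g, f ∈ p → g ∈ p → f * g ∈ p := by
    intro f g hf hg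
    induction hf, hg using Submodule.span_induction₂ with
    | mem_mem f g hf hg =>
      obtain ⟨k, rfl⟩ := hf
      obtain ⟨l, rfl⟩ := hg
      have : hartleyC hL k * hartleyC hL l
          = (1 / 2 : ℝ) • (hartleyC hL (k - l) + hartleyC hL (l - k))
            + (1 / 2 : ℝ) • (hartleyC hL (k + l) - hartleyC hL (-(k + l))) := by
        ext x
        exact hartley_mul hL k l x
      rw [this]
      exact p.add_mem (p.smul_mem _ (p.add_mem (hmem _) (hmem _)))
        (p.smul_mem _ (p.sub_mem (hmem _) (hmem _)))
    | zero_left g hg => simp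
    | zero_right f hf => simp
    | add_left f f' g _ _ _ h h' => rw [add_mul]; exact p.add_mem h h'
    | add_right f g g' _ _ _ h h' => rw [mul_add]; exact p.add_mem h h'
    | smul_left r f g _ _ h => rw [smul_mul_assoc]; exact p.smul_mem _ h
    | smul_right r f g _ _ h => rw [mul_smul_comm]; exact p.smul_mem _ h
  have hsep : (p.toSubalgebra h1 hmul).SeparatesPoints := by
    intro x y hxy
    by_contra hcon
    push Not at hcon
    refine hxy (eq_of_hartley_eq hL fun j => ⟨?_, ?_⟩)
    · exact hcon _ ⟨hartleyC hL (Pi.single j 1), hmem _, rfl⟩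
    · exact hcon _ ⟨hartleyC hL (-Pi.single j 1), hmem _, rfl⟩
  exact congr_arg Subalgebra.toSubmodule
    (ContinuousMap.subalgebra_topologicalClosure_eq_top_of_separatesPoints _ hsep)

/-- The normalized Hartley functions form an orthonormal basis of `L²(T)`. -/
theorem exists_hartley_hilbertBasis (hL : ∀ j, 0 < L j) :
    ∃ C : HilbertBasis (Fin (m + 1) → ℤ) ℝ (Lp ℝ 2 (vol L)),
      ∀ k, C k =ᵐ[vol L] fun x => (√(totalVolume L))⁻¹ * hartley L k x := by
  have := compactSpace hL
  let T := ContinuousMap.toLp (E := ℝ) 2 (vol L) ℝ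
  let c := (√(totalVolume L))⁻¹
  have hV := totalVolume_pos hL
  have hc : c ≠ 0 := inv_ne_zero (Real.sqrt_pos.2 hV).ne'
  have hcc : c * c * totalVolume L = 1 := by
    have := Real.mul_self_sqrt hV.le
    have h0 := (Real.sqrt_pos.2 hV).ne'
    simp only [c]
    field_simp
    nlinarith
  let e : (Fin (m + 1) → ℤ) → Lp ℝ 2 (vol L) := fun k => T (c • hartleyC hL k)
  have hae : ∀ k, e k =ᵐ[vol L] fun x => c * hartley L k x := fun k =>
    ContinuousMap.coeFn_toLp (vol L) (c • hartleyC hL k)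
  have horth : Orthonormal ℝ e := by
    rw [orthonormal_iff_ite]
    intro k l
    rw [inner_eq_integral (hae k) (hae l)]
    simp only [mul_mul_mul_comm c _ c, integral_const_mul, integral_hartley_mul hL, mul_ite, hcc,
      mul_zero]
  have hspan : Submodule.span ℝ (range e) = (Submodule.span ℝ (range (hartleyC hL))).map
      (T : C(Torus L, ℝ) →ₗ[ℝ] Lp ℝ 2 (vol L)) := by
    rw [Submodule.map_span, ← range_comp]
    refine le_antisymm (Submodule.span_le.2 ?_) (Submodule.span_le.2 ?_)
    · rintro _ ⟨k, rfl⟩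
      have : e k = c • T (hartleyC hL k) := map_smul T c _
      rw [SetLike.mem_coe, this]
      exact Submodule.smul_mem _ _ (Submodule.subset_span ⟨k, rfl⟩)
    · rintro _ ⟨k, rfl⟩
      have : T (hartleyC hL k) = c⁻¹ • e k := by simp [e, smul_smul, hc]
      change T (hartleyC hL k) ∈ Submodule.span ℝ (range e)
      rw [this]
      exact Submodule.smul_mem _ _ (Submodule.subset_span ⟨k, rfl⟩)
  have hdense : ⊤ ≤ (Submodule.span ℝ (range e)).topologicalClosure := by
    rw [hspan]
    exact ((ContinuousMap.toLp_denseRange ℝ (vol L) ℝ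
      (by simp)).topologicalClosure_map_submodule (span_hartleyC_closure_eq_top hL)).ge
  exact ⟨HilbertBasis.mk horth hdense, fun k => by rw [HilbertBasis.coe_mk]; exact hae k⟩

end L2

end FlatTorus

/-! ### Monotone enumerations and counting in Hilbert bases. -/

namespace FlatTorus

/-- An infinite type can be enumerated in nondecreasing order of any key with finite sublevel
sets. -/
theorem exists_monotone_enumeration {I α : Type*} [Countable I] [Infinite I] [LinearOrder α]
    (key : I → α) (hfin : ∀ i, {j | key j ≤ key i}.Finite) :
    ∃ σ : ℕ ≃ I, Monotone (key ∘ σ) := by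
  obtain ⟨enc, henc⟩ := exists_injective_nat I
  -- The second component breaks ties, so distinct indices have distinct positions.
  let e : I → α ×ₗ ℕ := fun i => toLex (key i, enc i)
  have he : Function.Injective e := fun i j h => henc (congrArg Prod.snd (toLex.injective h))
  have hkey : ∀ {i j}, e i ≤ e j → key i ≤ key j := fun {i j} h =>
    Prod.Lex.monotone_fst _ _ h
  have hfin' : ∀ i, {j | e j < e i}.Finite := fun i =>
    (hfin i).subset fun j (hj : e j < e i) => hkey hj.le
  let rank : I → ℕ := fun i => {j | e j < e i}.ncard
  have hrank : ∀ {i j}, e i < e j → rank i < rank j := fun {i j} h =>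
    ncard_lt_ncard ⟨fun l (hl : e l < e i) => hl.trans h, fun hsub => lt_irrefl (e i) (hsub h)⟩
      (hfin' j)
  have hinj : Function.Injective rank := by
    intro i j h
    by_contra hij
    rcases lt_or_gt_of_ne (he.ne hij) with hlt | hlt
    · exact (hrank hlt).ne h
    · exact (hrank hlt).ne h.symm
  have : Infinite (range rank) := (infinite_range_of_injective hinj).to_subtype
  have : DecidablePred (· ∈ range rank) := Classical.decPred _
  -- Surjectivity of `rank` is not needed: its infinite range is enumerated increasingly.
  let τ := Nat.Subtype.orderIsoOfNat (range rank)
  let σ : ℕ ≃ I := τ.toEquiv.trans (Equiv.ofInjective rank hinj).symm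
  have hσ : ∀ a, rank (σ a) = τ a := fun a =>
    Equiv.apply_ofInjective_symm hinj (τ a)
  refine ⟨σ, fun a b hab => hkey ?_⟩
  by_contra hcon
  have h1 := hrank (not_le.1 hcon)
  rw [hσ, hσ] at h1
  exact absurd (τ.monotone hab) (not_le.2 h1)

/-- This converts eigenvalue counts into statements about indices: for nondecreasing eigenvalues,
the indices below a threshold form an initial segment. -/
theorem mem_iff_lt_ncard_of_isLowerSet {S : Set ℕ} (hS : IsLowerSet S) (hfin : S.Finite) (j : ℕ) :
    j ∈ S ↔ j < S.ncard := by
  obtain ⟨N, hN⟩ : ∃ N, S = Iio N := by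
    have hex : ∃ N, N ∉ S := hfin.exists_notMem
    classical
    refine ⟨Nat.find hex, ext fun i => ⟨fun hi => ?_, fun hi => ?_⟩⟩
    · by_contra hcon
      exact Nat.find_spec hex (hS (not_lt.1 hcon) hi)
    · by_contra hcon
      exact absurd (Nat.find_min' hex hcon) (not_le.2 hi)
  subst hN
  have : (Iio N).ncard = N := by
    rw [← Nat.card_coe_set_eq]
    simp
  rw [this, mem_Iio]

section Hilbert

variable {E ι κ : Type*} [NormedAddCommGroup E] [InnerProductSpace ℝ E]

theorem eq_sum_of_inner_eq_zero (C : HilbertBasis κ ℝ E) (x : E) (q : Finset κ)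
    (h : ∀ k ∉ q, inner ℝ (C k) x = 0) : x = ∑ k ∈ q, inner ℝ (C k) x • C k := by
  have h1 := C.hasSum_repr x
  simp only [C.repr_apply_apply] at h1
  exact h1.unique (hasSum_sum_of_ne_finset_zero fun k hk => by rw [h k hk, zero_smul])

/-- An orthonormal family orthogonal to all but finitely many members of a Hilbert basis has at
most as many members as there are exceptions. -/
theorem finite_and_ncard_le_of_inner_eq_zero {B : ι → E} (hB : Orthonormal ℝ B)
    (C : HilbertBasis κ ℝ E) {p : Set ι} {q : Set κ} (hq : q.Finite)
    (h : ∀ i ∈ p, ∀ k ∉ q, inner ℝ (B i) (C k) = 0) : p.Finite ∧ p.ncard ≤ q.ncard := by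
  have key : ∀ F : Finset ι, ↑F ⊆ p → F.card ≤ q.ncard := by
    intro F hF
    have h1 : ∀ i ∈ F, (1 : ℝ) = ∑ k ∈ hq.toFinset, ‖inner ℝ (B i) (C k)‖ ^ 2 := by
      intro i hi
      have hs := C.hasSum_inner_mul_inner (B i) (B i)
      rw [real_inner_self_eq_norm_sq, hB.1 i, one_pow] at hs
      refine (hs.unique (hasSum_sum_of_ne_finset_zero (s := hq.toFinset) fun k hk => ?_)).trans ?_
      · rw [h i (hF hi) k (by simpa using hk), zero_mul]
      · refine Finset.sum_congr rfl fun k _ => ?_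
        rw [real_inner_comm (B i) (C k), Real.norm_eq_abs, sq_abs, sq]
    have h2 : (F.card : ℝ) ≤ q.ncard := by
      -- Double counting of squared coefficients: by Parseval each row sums to one, by Bessel each
      -- column sums to at most one.
      calc (F.card : ℝ) = ∑ i ∈ F, (1 : ℝ) := by simp
        _ = ∑ i ∈ F, ∑ k ∈ hq.toFinset, ‖inner ℝ (B i) (C k)‖ ^ 2 := Finset.sum_congr rfl h1
        _ = ∑ k ∈ hq.toFinset, ∑ i ∈ F, ‖inner ℝ (B i) (C k)‖ ^ 2 := Finset.sum_comm
        _ ≤ ∑ k ∈ hq.toFinset, 1 := Finset.sum_le_sum fun k _ =>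
            (hB.sum_inner_products_le (C k)).trans (by rw [C.orthonormal.1 k, one_pow])
        _ = q.ncard := by simp [ncard_eq_toFinset_card q hq]
    exact_mod_cast h2
  have hfin : p.Finite := by
    by_contra hinf
    obtain ⟨F, hF, hcard⟩ := Set.Infinite.exists_subset_card_eq hinf (q.ncard + 1)
    have := key F hF
    omega
  refine ⟨hfin, ?_⟩
  rw [ncard_eq_toFinset_card p hfin]
  exact key _ (by simp)

end Hilbert

end FlatTorus

/-! ### Eigenbases: the Hartley ones, and expansion of arbitrary ones. -/

namespace FlatTorus

variable {m : ℕ} {L : Fin (m + 1) → ℝ}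

theorem isEigenbasis_of_monotone (hL : ∀ j, 0 < L j) (σ : ℕ ≃ (Fin (m + 1) → ℤ))
    (hσ : Monotone (eigenvalue L ∘ σ)) :
    IsEigenbasis fun j (x : Torus L) => (√(totalVolume L))⁻¹ * hartley L (σ j) x where
  smooth j := contDiffOn_const.mul (smoothOn_hartley hL (σ j))
  eigen := by
    refine ⟨eigenvalue L ∘ σ, hσ, fun j x => ?_⟩
    obtain ⟨v, rfl⟩ := proj_surjective x
    have h := InnerProductSpace.laplacian_smul (x := v) (√(totalVolume L))⁻¹
      ((smoothOn_hartley hL (σ j)).contDiff.contDiffAt.of_le (by norm_cast))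
    have h2 := laplacian_hartley hL (σ j) (proj L v)
    rw [laplacian_proj] at h2 ⊢
    calc _ = -((√(totalVolume L))⁻¹ * Δ (hartley L (σ j) ∘ proj L) v) := congrArg Neg.neg h
      _ = _ := by
        rw [← mul_neg, h2]
        simp only [Function.comp]
        ring
  basis := by
    obtain ⟨C, hC⟩ := exists_hartley_hilbertBasis hL
    have hsp : ⊤ ≤ (Submodule.span ℝ (range (C ∘ σ))).topologicalClosure := by
      rw [σ.surjective.range_comp, C.dense_span]
    refine ⟨HilbertBasis.mk (C.orthonormal.comp σ σ.injective) hsp, fun j => ?_⟩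
    rw [HilbertBasis.coe_mk]
    exact hC (σ j)
  zero x := by
    -- Zero is the least eigenvalue and only the zero frequency has it, so a monotone enumeration
    -- starts there.
    have h0 : eigenvalue L 0 = 0 := (eigenvalue_eq_zero_iff hL 0).2 rfl
    have h : eigenvalue L (σ 0) = 0 := by
      refine le_antisymm ?_ (eigenvalue_nonneg _)
      have := hσ (Nat.zero_le (σ.symm 0))
      simpa [h0] using this
    rw [(eigenvalue_eq_zero_iff hL _).1 h, hartley_zero hL, mul_one]

/-- A family of Hartley functions containing those of `±` the unit frequency vectors embeds the
torus. -/
theorem isSmoothEmbedding_of_mem_range (hL : ∀ j, 0 < L j) {d : ℕ}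
    (σ : ℕ ≃ (Fin (m + 1) → ℤ)) (h1 : ∀ j, ∃ i : Fin d, σ (i + 1) = Pi.single j 1)
    (h2 : ∀ j, ∃ i : Fin d, σ (i + 1) = -Pi.single j 1) :
    IsSmoothEmbedding
      (eigenMap (fun j (x : Torus L) => (√(totalVolume L))⁻¹ * hartley L (σ j) x) d) := by
  set c := (√(totalVolume L))⁻¹ with hc
  have hc0 : c ≠ 0 := inv_ne_zero (Real.sqrt_pos.2 (totalVolume_pos hL)).ne'
  set Φ := eigenMap (fun j (x : Torus L) => c * hartley L (σ j) x) d with hΦ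
  have hΦi : ∀ i : Fin d, ∀ x, Φ x i = c * hartley L (σ (i + 1)) x := fun i x => rfl
  have hsmooth : SmoothOn Φ univ := by
    refine contDiffOn_piLp' 2 fun i => ?_
    exact contDiffOn_const.mul (smoothOn_hartley hL (σ (i + 1)))
  refine ⟨hsmooth, fun v => ?_, ?_⟩
  · rw [injective_iff_map_eq_zero]
    intro w hw
    have hd : HasFDerivAt (Φ ∘ proj L) (fderiv ℝ (Φ ∘ proj L) v) v :=
      (hsmooth.contDiff.differentiable (by simp) v).hasFDerivAt
    have key : ∀ i : Fin d, (Real.cos (phase L (σ (i + 1)) v) - Real.sin (phase L (σ (i + 1)) v))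
        * phase L (σ (i + 1)) w = 0 := by
      intro i
      have e1 := (EuclideanSpace.proj (𝕜 := ℝ) i).hasFDerivAt.comp v hd
      have e2 := (hasFDerivAt_hartley hL (σ (i + 1)) v).const_mul c
      have e3 := congrArg (fun A => A w) (e1.unique e2)
      simp only [ContinuousLinearMap.comp_apply, hw, map_zero, smul_apply,
        smul_eq_mul] at e3
      exact (mul_eq_zero.1 e3.symm).resolve_left hc0
    ext j
    obtain ⟨i, hi⟩ := h1 j
    obtain ⟨i', hi'⟩ := h2 j
    have k1 := key i
    have k2 := key i'
    rw [hi] at k1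
    rw [hi'] at k2
    simp only [phase_neg, Real.cos_neg, Real.sin_neg] at k2
    set p := phase L (Pi.single j 1) w with hp
    -- The two signs give `(cos - sin) p = 0` and `(cos + sin) p = 0`, so `p` is killed by both
    -- `cos` and `sin`, which have no common zero.
    have hp0 : p = 0 := by
      have hsq := Real.sin_sq_add_cos_sq (phase L (Pi.single j 1) v)
      have hC : Real.cos (phase L (Pi.single j 1) v) * p = 0 := by linarith
      have hS : Real.sin (phase L (Pi.single j 1) v) * p = 0 := by linarith
      calc p = (Real.sin (phase L (Pi.single j 1) v) ^ 2
            + Real.cos (phase L (Pi.single j 1) v) ^ 2) * p := by rw [hsq, one_mul]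
        _ = Real.sin (phase L (Pi.single j 1) v) * (Real.sin (phase L (Pi.single j 1) v) * p)
            + Real.cos (phase L (Pi.single j 1) v)
              * (Real.cos (phase L (Pi.single j 1) v) * p) := by
          ring
        _ = 0 := by rw [hC, hS]; ring
    rw [hp, phase_single] at hp0
    simpa [Real.pi_ne_zero, (hL j).ne'] using hp0
  · have := compactSpace hL
    refine (hsmooth.continuous.isClosedEmbedding fun x y hxy => ?_).isEmbedding
    have hval : ∀ i : Fin d, hartley L (σ (i + 1)) x = hartley L (σ (i + 1)) y := by
      intro i
      have := congrArg (fun u : EuclideanSpace ℝ (Fin d) => u i) hxy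
      simp only [hΦi] at this
      exact mul_left_cancel₀ hc0 this
    refine eq_of_hartley_eq hL fun j => ⟨?_, ?_⟩
    · obtain ⟨i, hi⟩ := h1 j
      exact hi ▸ hval i
    · obtain ⟨i, hi⟩ := h2 j
      exact hi ▸ hval i

/-- Every eigenbasis has the same eigenvalues, counted with multiplicity, as the Hartley functions,
and its members are finite combinations of Hartley functions of the same eigenvalue. -/
theorem IsEigenbasis.exists_expansion (hL : ∀ j, 0 < L j) {φ : ℕ → Torus L → ℝ}
    (hφ : IsEigenbasis φ) :
    ∃ ev : ℕ → ℝ, Monotone ev ∧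
      (∀ A : Set ℝ, {k | eigenvalue L k ∈ A}.Finite →
        {j | ev j ∈ A}.Finite ∧ {j | ev j ∈ A}.ncard = {k | eigenvalue L k ∈ A}.ncard) ∧
      ∀ j, ∃ (s : Finset (Fin (m + 1) → ℤ)) (c : (Fin (m + 1) → ℤ) → ℝ),
        (∀ k ∈ s, eigenvalue L k = ev j) ∧ ∀ x, φ j x = ∑ k ∈ s, c k * hartley L k x := by
  obtain ⟨ev, hmono, hev⟩ := hφ.eigen
  obtain ⟨B, hB⟩ := hφ.basis
  obtain ⟨C, hC⟩ := exists_hartley_hilbertBasis hL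
  have horth : ∀ j k, ev j ≠ eigenvalue L k → inner ℝ (B j) (C k) = 0 := by
    intro j k hjk
    rw [inner_eq_integral (hB j) (hC k)]
    simp only [mul_left_comm _ (√(totalVolume L))⁻¹]
    rw [integral_const_mul, integral_mul_eq_zero_of_eigen hL (hφ.smooth j) (smoothOn_hartley hL k)
      (hev j) (laplacian_hartley hL k) hjk, mul_zero]
  refine ⟨ev, hmono, fun A hA => ?_, fun j => ?_⟩
  -- The comparison of cardinalities is applied twice, with the two bases exchanged.
  · obtain ⟨hfin, hle⟩ := finite_and_ncard_le_of_inner_eq_zero B.orthonormal C hA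
      (p := {j | ev j ∈ A}) fun j hj k hk => horth j k fun h => hk (by
        change eigenvalue L k ∈ A
        exact h ▸ hj)
    refine ⟨hfin, le_antisymm hle ?_⟩
    exact (finite_and_ncard_le_of_inner_eq_zero C.orthonormal B hfin
      (p := {k | eigenvalue L k ∈ A}) fun k hk j hj => by
        rw [real_inner_comm]
        exact horth j k fun h => hj (by
          change ev j ∈ A
          exact h ▸ hk)).2
  · have hfin : {k | eigenvalue L k = ev j}.Finite :=
      (finite_eigenvalue_le hL (ev j)).subset fun k hk => le_of_eq hk
    set s := hfin.toFinset with hs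
    have hsum := eq_sum_of_inner_eq_zero C (B j) s fun k hk => by
      rw [real_inner_comm]
      exact horth j k fun h => hk (by simpa [hs] using h.symm)
    refine ⟨s, fun k => inner ℝ (C k) (B j) * (√(totalVolume L))⁻¹, fun k hk => by
      simpa [hs] using hk, fun x => ?_⟩
    have := isOpenPosMeasure_vol hL
    have hcont : Continuous fun x => ∑ k ∈ s,
        inner ℝ (C k) (B j) * (√(totalVolume L))⁻¹ * hartley L k x :=
      continuous_finsetSum _ fun k _ => continuous_const.mul (continuous_hartley hL k)
    -- Both sides are continuous and nonempty open sets have positive measure, so the `L²` identity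
    -- holds pointwise.
    refine congrFun (((hφ.smooth j).continuous.ae_eq_iff_eq (vol L) hcont).1 ?_) x
    have hsum' : (B j : Torus L → ℝ) =ᵐ[vol L]
        fun x => ∑ k ∈ s, inner ℝ (C k) (B j) * C k x := by
      have h1 := congrArg (fun F : Lp ℝ 2 (vol L) => (F : Torus L → ℝ)) hsum
      rw [h1]
      refine (Lp.coeFn_finsetSum _ _).trans ?_
      have h2 : ∀ᵐ x ∂vol L, ∀ k ∈ s,
          (inner ℝ (C k) (B j) • C k : Lp ℝ 2 (vol L)) x = inner ℝ (C k) (B j) * C k x := by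
        rw [Finset.eventually_all]
        exact fun k _ => Lp.coeFn_smul (inner ℝ (C k) (B j)) (C k)
      filter_upwards [h2] with x hx
      rw [Finset.sum_apply]
      exact Finset.sum_congr rfl hx
    have hC' : ∀ᵐ x ∂vol L, ∀ k ∈ s, C k x = (√(totalVolume L))⁻¹ * hartley L k x := by
      rw [Finset.eventually_all]
      exact fun k _ => hC k
    filter_upwards [hB j, hsum', hC'] with x h1 h2 h3
    rw [← h1, h2]
    refine Finset.sum_congr rfl fun k hk => ?_
    rw [h3 k hk, mul_assoc]

end FlatTorus

namespace FlatTorus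

/-! ### Low spectrum of the stretched torus and the upper bound. -/

section Stretched

variable {N : ℕ} {a b : ℝ}

theorem stretchedSides_castSucc (i : Fin (N + 1)) :
    stretchedSides (N + 2) a b i.castSucc = a := by
  have := i.2
  rw [stretchedSides, if_neg]
  simp only [Fin.val_castSucc]
  omega

theorem stretchedSides_last : stretchedSides (N + 2) a b (Fin.last (N + 1)) = b := by
  simp [stretchedSides]

theorem stretchedSides_pos (ha : 0 < a) (hab : a < b) (j : Fin (N + 2)) :
    0 < stretchedSides (N + 2) a b j := by
  rw [stretchedSides]
  split_ifs
  · exact ha.trans hab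
  · exact ha

/-- The eigenvalue of a character with unit frequency in one of the short directions. -/
noncomputable def shortEigenvalue (a : ℝ) : ℝ := (2 * Real.pi / a) ^ 2

/-- In units of the short eigenvalue, every spectral question becomes a comparison of this sum with
`1`. -/
theorem eigenvalue_stretched (ha : 0 < a) (hab : a < b) (k : Fin (N + 2) → ℤ) :
    eigenvalue (stretchedSides (N + 2) a b) k = shortEigenvalue a *
      (∑ i : Fin (N + 1), (k i.castSucc : ℝ) ^ 2
        + (k (Fin.last (N + 1)) : ℝ) ^ 2 / (b / a) ^ 2) := by
  rw [eigenvalue, Fin.sum_univ_castSucc, stretchedSides_last, shortEigenvalue, mul_add,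
    Finset.mul_sum]
  simp only [stretchedSides_castSucc]
  have := ha.ne'
  have := (ha.trans hab).ne'
  congr 1
  · refine Finset.sum_congr rfl fun i _ => ?_
    ring
  · field_simp

theorem shortEigenvalue_pos (ha : 0 < a) : 0 < shortEigenvalue a := by
  rw [shortEigenvalue]
  positivity

/-- Below the short eigenvalue there are only functions of the last coordinate. -/
theorem eigenvalue_lt_iff (ha : 0 < a) (hab : a < b) (k : Fin (N + 2) → ℤ) :
    eigenvalue (stretchedSides (N + 2) a b) k < shortEigenvalue a ↔
      (∀ i : Fin (N + 1), k i.castSucc = 0) ∧ |(k (Fin.last (N + 1)) : ℝ)| < b / a := by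
  have hba : 0 < b / a := div_pos (ha.trans hab) ha
  rw [eigenvalue_stretched ha hab, mul_lt_iff_lt_one_right (shortEigenvalue_pos ha)]
  have hlast : (k (Fin.last (N + 1)) : ℝ) ^ 2 / (b / a) ^ 2 < 1 ↔
      |(k (Fin.last (N + 1)) : ℝ)| < b / a := by
    rw [div_lt_one (by positivity), sq_lt_sq, abs_of_pos hba]
  constructor
  · intro h
    have h0 : 0 ≤ (k (Fin.last (N + 1)) : ℝ) ^ 2 / (b / a) ^ 2 := by positivity
    have h1 : ∀ i : Fin (N + 1), (k i.castSucc : ℝ) ^ 2 < 1 := fun i =>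
      lt_of_le_of_lt (Finset.single_le_sum (f := fun i : Fin (N + 1) => (k i.castSucc : ℝ) ^ 2)
        (fun _ _ => sq_nonneg _) (Finset.mem_univ i)) (by linarith)
    refine ⟨fun i => ?_, hlast.1 ?_⟩
    · have h2 : (k i.castSucc) ^ 2 < 1 := by exact_mod_cast h1 i
      rw [sq_lt_one_iff_abs_lt_one] at h2
      exact Int.abs_lt_one_iff.1 h2
    · have : 0 ≤ ∑ i : Fin (N + 1), (k i.castSucc : ℝ) ^ 2 :=
        Finset.sum_nonneg fun _ _ => sq_nonneg _
      linarith
  · rintro ⟨h1, h2⟩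
    simp only [h1]
    simpa using hlast.2 h2

/-- At the short eigenvalue there are only unit frequencies in the short directions and functions of
the last coordinate. -/
theorem eq_single_of_eigenvalue_eq (ha : 0 < a) (hab : a < b) {k : Fin (N + 2) → ℤ}
    (hk : eigenvalue (stretchedSides (N + 2) a b) k = shortEigenvalue a) :
    (∀ i : Fin (N + 1), k i.castSucc = 0) ∨
      ∃ i : Fin (N + 1), k = Pi.single i.castSucc 1 ∨ k = -Pi.single i.castSucc 1 := by
  have hba : 0 < b / a := div_pos (ha.trans hab) ha
  rw [eigenvalue_stretched ha hab, mul_eq_left₀ (shortEigenvalue_pos ha).ne'] at hk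
  by_cases h : ∀ i : Fin (N + 1), k i.castSucc = 0
  · exact Or.inl h
  right
  push Not at h
  obtain ⟨i, hi⟩ := h
  have hsplit := Finset.add_sum_erase Finset.univ
    (fun i : Fin (N + 1) => (k i.castSucc : ℝ) ^ 2) (Finset.mem_univ i)
  have h1 : (1 : ℝ) ≤ (k i.castSucc : ℝ) ^ 2 := by
    have : 1 ≤ (k i.castSucc) ^ 2 := Int.add_one_le_of_lt (sq_pos_of_ne_zero hi)
    exact_mod_cast this
  have h2 : 0 ≤ ∑ j ∈ Finset.univ.erase i, (k (Fin.castSucc j) : ℝ) ^ 2 :=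
    Finset.sum_nonneg fun _ _ => sq_nonneg _
  have h3 : 0 ≤ (k (Fin.last (N + 1)) : ℝ) ^ 2 / (b / a) ^ 2 := by positivity
  have e1 : (k i.castSucc : ℝ) ^ 2 = 1 := by linarith
  have e2 : ∑ j ∈ Finset.univ.erase i, (k (Fin.castSucc j) : ℝ) ^ 2 = 0 := by linarith
  have e3 : (k (Fin.last (N + 1)) : ℝ) ^ 2 / (b / a) ^ 2 = 0 := by linarith
  have f1 : k i.castSucc = 1 ∨ k i.castSucc = -1 := by
    have : (k i.castSucc) ^ 2 = 1 := by exact_mod_cast e1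
    rwa [sq, mul_self_eq_one_iff] at this
  have f2 : ∀ j, j ≠ i → k (Fin.castSucc j) = 0 := by
    intro j hj
    have := (Finset.sum_eq_zero_iff_of_nonneg fun _ _ => sq_nonneg _).1 e2 j
      (Finset.mem_erase.2 ⟨hj, Finset.mem_univ j⟩)
    simpa using this
  have f3 : k (Fin.last (N + 1)) = 0 := by
    have : (b / a) ^ 2 ≠ 0 := by positivity
    simpa [this, hba.ne', ha.ne', (ha.trans hab).ne'] using e3
  have f4 : k = Pi.single i.castSucc (k i.castSucc) := by
    funext j
    refine Fin.lastCases ?_ (fun j => ?_) j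
    · rw [f3, Pi.single_eq_of_ne (Fin.castSucc_lt_last i).ne']
    · by_cases hj : j = i
      · rw [hj, Pi.single_eq_same]
      · rw [f2 j hj, Pi.single_eq_of_ne (by simpa using hj)]
  refine ⟨i, f1.imp (fun h => ?_) fun h => ?_⟩
  · rw [f4, h]
  · rw [f4, h, Pi.single_neg]

theorem eigenvalue_single_castSucc (ha : 0 < a) (hab : a < b) (i : Fin (N + 1)) :
    eigenvalue (stretchedSides (N + 2) a b) (Pi.single i.castSucc 1) = shortEigenvalue a := by
  rw [eigenvalue_stretched ha hab, Finset.sum_eq_single i]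
  · simp
  · intro j _ hj
    simp [hj]
  · simp

/-- The frequency vectors with eigenvalue below the short one. -/
def lowFrequencies (N : ℕ) (a b : ℝ) : Set (Fin (N + 2) → ℤ) :=
  {k | eigenvalue (stretchedSides (N + 2) a b) k < shortEigenvalue a}

/-- The unit frequency vectors in the short directions, up to sign. -/
def shortFrequencies (N : ℕ) : Set (Fin (N + 2) → ℤ) :=
  range fun p : Fin (N + 1) × Bool =>
    if p.2 then Pi.single p.1.castSucc 1 else -Pi.single p.1.castSucc 1

/-- `K` is the largest integer strictly below `b / a`, also when `b / a` is an integer; the count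
includes the zero frequency. -/
theorem ncard_lowFrequencies (ha : 0 < a) (hab : a < b) {K : ℕ} (hK : (⌈b / a⌉ : ℤ) = K + 1) :
    (lowFrequencies N a b).ncard = 2 * K + 1 := by
  have h : lowFrequencies N a b
      = (fun z : ℤ => (Pi.single (Fin.last (N + 1)) z : Fin (N + 2) → ℤ)) '' Icc (-K : ℤ) K := by
    ext k
    rw [lowFrequencies, mem_ofPred_eq, eigenvalue_lt_iff ha hab]
    have habs : |(k (Fin.last (N + 1)) : ℝ)| < b / a ↔ |k (Fin.last (N + 1))| ≤ K := by
      rw [← Int.cast_abs, ← Int.lt_ceil, hK, Int.lt_add_one_iff]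
    rw [habs, abs_le]
    constructor
    · rintro ⟨h1, h2⟩
      refine ⟨k (Fin.last (N + 1)), h2, funext fun j => ?_⟩
      refine Fin.lastCases ?_ (fun j => ?_) j
      · simp
      · rw [h1 j]
        exact Pi.single_eq_of_ne (Fin.castSucc_lt_last j).ne _
    · rintro ⟨z, hz, rfl⟩
      refine ⟨fun i => Pi.single_eq_of_ne (Fin.castSucc_lt_last i).ne _, ?_⟩
      simpa using hz
  have hinj : Function.Injective fun z : ℤ => (Pi.single (Fin.last (N + 1)) z : Fin (N + 2) → ℤ) :=
    Pi.single_injective (M := fun _ : Fin (N + 2) => ℤ) (Fin.last (N + 1))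
  rw [h, ncard_image_of_injective _ hinj, ncard_eq_toFinset_card']
  simp
  omega

theorem finite_shortFrequencies (N : ℕ) : (shortFrequencies N).Finite := finite_range _

theorem ncard_shortFrequencies (N : ℕ) : (shortFrequencies N).ncard = 2 * (N + 1) := by
  have hinj : Function.Injective fun p : Fin (N + 1) × Bool =>
      if p.2 then (Pi.single p.1.castSucc 1 : Fin (N + 2) → ℤ) else -Pi.single p.1.castSucc 1 := by
    rintro ⟨i, s⟩ ⟨j, t⟩ h
    have h1 := congrFun h i.castSucc
    by_cases hij : i = j
    · subst hij
      cases s <;> cases t <;> simp at h1 ⊢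
    · have hij' : i.castSucc ≠ j.castSucc := by simpa using hij
      cases s <;> cases t <;> simp [hij] at h1
  rw [shortFrequencies, ← image_univ, ncard_image_of_injective _ hinj, ncard_univ]
  simp
  ring

theorem eigenvalue_of_mem_shortFrequencies (ha : 0 < a) (hab : a < b) {k : Fin (N + 2) → ℤ}
    (hk : k ∈ shortFrequencies N) :
    eigenvalue (stretchedSides (N + 2) a b) k = shortEigenvalue a := by
  obtain ⟨⟨i, s⟩, rfl⟩ := hk
  cases s
  · simp [eigenvalue_neg, eigenvalue_single_castSucc ha hab]
  · simp [eigenvalue_single_castSucc ha hab]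

theorem finite_lowFrequencies (ha : 0 < a) (hab : a < b) : (lowFrequencies N a b).Finite :=
  (finite_eigenvalue_le (stretchedSides_pos ha hab) (shortEigenvalue a)).subset
    fun k hk => by
      change eigenvalue _ k < _ at hk
      exact hk.le

theorem ncard_lowFrequencies_union (ha : 0 < a) (hab : a < b) {K : ℕ}
    (hK : (⌈b / a⌉ : ℤ) = K + 1) :
    (lowFrequencies N a b ∪ shortFrequencies N).ncard = 2 * (K + 1 + N) + 1 := by
  rw [ncard_union_eq ?_ (finite_lowFrequencies ha hab) (finite_shortFrequencies N),
    ncard_lowFrequencies ha hab hK, ncard_shortFrequencies]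
  · ring
  · rw [disjoint_left]
    intro k hk hk'
    exact hk.ne (eigenvalue_of_mem_shortFrequencies ha hab hk')

/-- Tie-breaking matters when `b / a` is an integer: the frequencies `±b/a` in the long direction
then share the short eigenvalue and must come after the unit ones. The Boolean in `key` enforces
this, since `false < true`. -/
theorem exists_embedding_eigenbasis (ha : 0 < a) (hab : a < b) {K : ℕ}
    (hK : (⌈b / a⌉ : ℤ) = K + 1) :
    ∃ φ : ℕ → Torus (stretchedSides (N + 2) a b) → ℝ,
      IsEigenbasis φ ∧ IsSmoothEmbedding (eigenMap φ (2 * (K + 1 + N))) := by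
  classical
  set L := stretchedSides (N + 2) a b with hLdef
  have hL : ∀ j, 0 < L j := stretchedSides_pos ha hab
  set P := lowFrequencies N a b ∪ shortFrequencies N with hP
  let key : (Fin (N + 2) → ℤ) → ℝ ×ₗ Bool := fun k => toLex (eigenvalue L k, decide (k ∉ P))
  have hkey : ∀ {k l}, key k ≤ key l → eigenvalue L k ≤ eigenvalue L l := fun {k l} h =>
    Prod.Lex.monotone_fst _ _ h
  obtain ⟨σ, hσ⟩ := exists_monotone_enumeration key fun k =>
    (finite_eigenvalue_le hL (eigenvalue L k)).subset fun l hl => hkey hl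
  have hmono : Monotone (eigenvalue L ∘ σ) := fun i j hij => hkey (hσ hij)
  have hlow : ∀ {k l}, k ∈ P → l ∉ P → key k < key l := by
    intro k l hk hl
    have hkl : eigenvalue L k ≤ shortEigenvalue a := by
      rcases hk with hk | hk
      · exact le_of_lt hk
      · exact (eigenvalue_of_mem_shortFrequencies ha hab hk).le
    have hl' : shortEigenvalue a ≤ eigenvalue L l := not_lt.1 fun h => hl (Or.inl h)
    rw [Prod.Lex.toLex_lt_toLex]
    rcases (hkl.trans hl').lt_or_eq with h | h
    · exact Or.inl h
    · exact Or.inr ⟨h, by simp [hk, hl]⟩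
  have hlower : IsLowerSet (σ ⁻¹' P) := by
    intro i j hji hi
    by_contra hj
    exact absurd (hσ hji) (not_le.2 (hlow hi hj))
  have hPfin : P.Finite := (finite_lowFrequencies ha hab).union (finite_shortFrequencies N)
  have hcard : (σ ⁻¹' P).ncard = 2 * (K + 1 + N) + 1 := by
    rw [ncard_preimage_of_injective_subset_range σ.injective (by simp [σ.surjective.range_eq]),
      ncard_lowFrequencies_union ha hab hK]
  have hfin : (σ ⁻¹' P).Finite := hPfin.preimage σ.injective.injOn
  have hbasis := isEigenbasis_of_monotone hL σ hmono
  have hzero : σ 0 = 0 := by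
    have h0 : eigenvalue L 0 = 0 := (eigenvalue_eq_zero_iff hL 0).2 rfl
    refine (eigenvalue_eq_zero_iff hL _).1 (le_antisymm ?_ (eigenvalue_nonneg _))
    have := hmono (Nat.zero_le (σ.symm 0))
    simpa [h0] using this
  have hindex : ∀ k ∈ P, k ≠ 0 → ∃ i : Fin (2 * (K + 1 + N)), σ (i + 1) = k := by
    intro k hk hk0
    have h1 : σ.symm k ∈ σ ⁻¹' P := by simpa using hk
    rw [mem_iff_lt_ncard_of_isLowerSet hlower hfin, hcard] at h1
    have h2 : σ.symm k ≠ 0 := fun h => hk0 (by rw [← hzero, ← h, σ.apply_symm_apply])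
    -- Position `0` holds the constant, which `eigenMap` omits; hence the shift by one.
    refine ⟨⟨σ.symm k - 1, by omega⟩, ?_⟩
    rw [Nat.sub_add_cancel (Nat.one_le_iff_ne_zero.2 h2), σ.apply_symm_apply]
  have hsingle : ∀ j : Fin (N + 2), (Pi.single j 1 : Fin (N + 2) → ℤ) ∈ P ∧
      (-Pi.single j 1 : Fin (N + 2) → ℤ) ∈ P := by
    intro j
    refine Fin.lastCases ?_ (fun i => ?_) j
    · have h : (Pi.single (Fin.last (N + 1)) 1 : Fin (N + 2) → ℤ) ∈ lowFrequencies N a b := by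
        rw [lowFrequencies, mem_ofPred_eq, eigenvalue_lt_iff ha hab]
        refine ⟨fun i => Pi.single_eq_of_ne (Fin.castSucc_lt_last i).ne _, ?_⟩
        simpa using (one_lt_div ha).2 hab
      refine ⟨Or.inl h, Or.inl ?_⟩
      rw [lowFrequencies, mem_ofPred_eq, eigenvalue_neg]
      exact h
    · exact ⟨Or.inr ⟨(i, true), by simp⟩, Or.inr ⟨(i, false), by simp⟩⟩
  have hne : ∀ j : Fin (N + 2), (Pi.single j 1 : Fin (N + 2) → ℤ) ≠ 0 := fun j h => by
    simpa using congrFun h j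
  exact ⟨_, hbasis, isSmoothEmbedding_of_mem_range hL σ
    (fun j => hindex _ (hsingle j).1 (hne j))
    (fun j => hindex _ (hsingle j).2 (neg_ne_zero.2 (hne j)))⟩

end Stretched

end FlatTorus

/-! ### The lower bound, by restriction to a slice. -/

namespace FlatTorus

/-- Every complex number of modulus at most two is a difference of two unit complex numbers. -/
theorem exists_exp_sub_exp_eq {w : ℂ} (hw : ‖w‖ ≤ 2) :
    ∃ α β : ℝ, Complex.exp (α * Complex.I) - Complex.exp (β * Complex.I) = w := by
  set γ := Real.arccos (‖w‖ / 2) with hγ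
  have hcos : 2 * Real.cos γ = ‖w‖ := by
    rw [hγ, Real.cos_arccos (by linarith [norm_nonneg w]) (by linarith)]
    ring
  -- As `-exp(i(π - γ)) = exp(-iγ)`, the difference is `exp(i arg w) · 2 cos γ`.
  refine ⟨w.arg + γ, w.arg + (Real.pi - γ), ?_⟩
  have h := Complex.norm_mul_exp_arg_mul_I w
  conv_rhs => rw [← h, ← hcos]
  push_cast
  simp only [add_mul, sub_mul, Complex.exp_add, Complex.exp_sub, Complex.exp_pi_mul_I]
  rw [Complex.cos, neg_mul, Complex.exp_neg]
  field_simp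
  ring

section Slice

variable {N : ℕ} {a b : ℝ}

/-- The point of the slice on which the last coordinate vanishes with phases `θ`. -/
noncomputable def slice (a : ℝ) (θ : Fin (N + 1) → ℝ) : EuclideanSpace ℝ (Fin (N + 2)) :=
  WithLp.toLp 2 (Fin.snoc (fun i => a * θ i / (2 * Real.pi)) 0 : Fin (N + 2) → ℝ)

theorem phase_slice (ha : 0 < a) (k : Fin (N + 2) → ℤ) (θ : Fin (N + 1) → ℝ) :
    phase (stretchedSides (N + 2) a b) k (slice a θ) = ∑ i : Fin (N + 1), k i.castSucc * θ i := by
  rw [phase_apply, Fin.sum_univ_castSucc]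
  have := ha.ne'
  have := Real.pi_ne_zero
  simp only [slice, stretchedSides_castSucc, Fin.snoc_castSucc, Fin.snoc_last, mul_zero, add_zero]
  refine Finset.sum_congr rfl fun i _ => ?_
  field_simp

theorem phase_single_slice (ha : 0 < a) (i : Fin (N + 1)) (θ : Fin (N + 1) → ℝ) :
    phase (stretchedSides (N + 2) a b) (Pi.single i.castSucc 1) (slice a θ) = θ i := by
  rw [phase_slice ha, Finset.sum_eq_single i]
  · simp
  · intro j _ hj
    simp [hj]
  · simp

/-- On the slice, the Hartley functions up to the short eigenvalue are affine functions of the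
unit complex numbers `exp (i θⱼ)`, and constant below the short eigenvalue. -/
theorem exists_hartley_slice_eq (ha : 0 < a) (hab : a < b) {k : Fin (N + 2) → ℤ}
    (hk : eigenvalue (stretchedSides (N + 2) a b) k ≤ shortEigenvalue a) :
    ∃ (ℓ : (Fin (N + 1) → ℂ) →ₗ[ℝ] ℝ) (c : ℝ),
      (eigenvalue (stretchedSides (N + 2) a b) k < shortEigenvalue a → ℓ = 0) ∧
      ∀ θ : Fin (N + 1) → ℝ, hartley (stretchedSides (N + 2) a b) k (proj _ (slice a θ))
        = c + ℓ fun i => Complex.exp (θ i * Complex.I) := by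
  have hL := stretchedSides_pos (N := N) ha hab
  have hconst : (∀ i : Fin (N + 1), k i.castSucc = 0) → ∀ θ : Fin (N + 1) → ℝ,
      hartley (stretchedSides (N + 2) a b) k (proj _ (slice a θ)) = 1 := by
    intro h θ
    rw [hartley_proj hL, phase_slice ha]
    simp [h]
  have hproj : ∀ (i : Fin (N + 1)) (w : Fin (N + 1) → ℂ),
      (LinearMap.proj i : (Fin (N + 1) → ℂ) →ₗ[ℝ] ℂ) w = w i := fun i w => rfl
  rcases hk.lt_or_eq with hlt | heq
  · refine ⟨0, 1, fun _ => rfl, fun θ => ?_⟩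
    rw [hconst ((eigenvalue_lt_iff ha hab k).1 hlt).1]
    simp
  · rcases eq_single_of_eigenvalue_eq ha hab heq with h | ⟨i, rfl | rfl⟩
    -- This case arises only for frequencies `±b/a` in the long direction, whose functions are
    -- constant on the slice.
    · refine ⟨0, 1, fun _ => rfl, fun θ => ?_⟩
      rw [hconst h]
      simp
    · refine ⟨(Complex.reLm + Complex.imLm) ∘ₗ LinearMap.proj i, 0, fun h => absurd heq h.ne,
        fun θ => ?_⟩
      rw [hartley_proj hL, phase_single_slice ha]
      simp [Complex.exp_ofReal_mul_I_re, Complex.exp_ofReal_mul_I_im]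
    · refine ⟨(Complex.reLm - Complex.imLm) ∘ₗ LinearMap.proj i, 0, fun h => absurd heq h.ne,
        fun θ => ?_⟩
      rw [hartley_proj hL, phase_neg, phase_single_slice ha]
      simp [Complex.exp_ofReal_mul_I_re, Complex.exp_ofReal_mul_I_im, sub_eq_add_neg]

/-- Used to see that the two slice points built from a nonzero kernel vector are distinct in the
torus. -/
theorem exp_eq_of_proj_slice_eq (ha : 0 < a) (hab : a < b) {θ θ' : Fin (N + 1) → ℝ}
    (h : proj (stretchedSides (N + 2) a b) (slice a θ) = proj _ (slice a θ')) (i : Fin (N + 1)) :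
    Complex.exp (θ i * Complex.I) = Complex.exp (θ' i * Complex.I) := by
  have hL := stretchedSides_pos (N := N) ha hab
  obtain ⟨h1, h2⟩ := cos_sin_eq_of_hartley_eq hL (k := Pi.single i.castSucc 1)
    (congrArg _ h) (congrArg _ h)
  rw [phase_single_slice ha, phase_single_slice ha] at h1 h2
  rw [Complex.exp_mul_I, Complex.exp_mul_I, ← Complex.ofReal_cos, ← Complex.ofReal_sin, h1, h2,
    Complex.ofReal_cos, Complex.ofReal_sin]

/-- An eigenbasis map with fewer than `2 (⌈b/a⌉ + N)` components is not injective. -/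
theorem le_of_injective_eigenMap (ha : 0 < a) (hab : a < b) {K : ℕ}
    (hK : (⌈b / a⌉ : ℤ) = K + 1) {φ : ℕ → Torus (stretchedSides (N + 2) a b) → ℝ}
    (hφ : IsEigenbasis φ) {m : ℕ} (hinj : Function.Injective (eigenMap φ m)) :
    2 * (K + 1 + N) ≤ m := by
  by_contra! hm
  have hL := stretchedSides_pos (N := N) ha hab
  obtain ⟨ev, hmono, hcount, hexp⟩ := hφ.exists_expansion hL
  have hlt : ∀ j, ev j < shortEigenvalue a ↔ j < 2 * K + 1 := by
    intro j
    obtain ⟨hfin, hcard⟩ := hcount (Iio (shortEigenvalue a)) (finite_lowFrequencies ha hab)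
    have hcard' : {k | eigenvalue (stretchedSides (N + 2) a b) k ∈ Iio (shortEigenvalue a)}.ncard
        = 2 * K + 1 :=
      ncard_lowFrequencies ha hab hK
    have hlow : IsLowerSet {j | ev j ∈ Iio (shortEigenvalue a)} := fun i j hji hi =>
      lt_of_le_of_lt (hmono hji) hi
    have := mem_iff_lt_ncard_of_isLowerSet hlow hfin j
    rwa [hcard, hcard'] at this
  have hle : ∀ j ≤ 2 * (K + 1 + N), ev j ≤ shortEigenvalue a := by
    intro j hj
    have hfinite := finite_eigenvalue_le hL (shortEigenvalue a)
    obtain ⟨hfin, hcard⟩ := hcount (Iic (shortEigenvalue a)) hfinite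
    -- An inclusion suffices; it is strict when `b / a` is an integer.
    have hsub : lowFrequencies N a b ∪ shortFrequencies N
        ⊆ {k | eigenvalue (stretchedSides (N + 2) a b) k ∈ Iic (shortEigenvalue a)} := by
      rintro k (hk | hk)
      · change eigenvalue _ k < _ at hk
        exact hk.le
      · exact (eigenvalue_of_mem_shortFrequencies ha hab hk).le
    have hcard' := ncard_le_ncard hsub hfinite
    rw [ncard_lowFrequencies_union ha hab hK] at hcard'
    have hlow : IsLowerSet {j | ev j ∈ Iic (shortEigenvalue a)} := fun i j hji hi =>
      le_trans (hmono hji) hi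
    exact (mem_iff_lt_ncard_of_isLowerSet hlow hfin j).2
      (lt_of_lt_of_le (by omega) (hcard'.trans hcard.ge))
  have hslice : ∀ j ≤ 2 * (K + 1 + N), ∃ (ℓ : (Fin (N + 1) → ℂ) →ₗ[ℝ] ℝ) (c : ℝ),
      (j < 2 * K + 1 → ℓ = 0) ∧
      ∀ θ : Fin (N + 1) → ℝ, φ j (proj _ (slice a θ))
        = c + ℓ fun i => Complex.exp (θ i * Complex.I) := by
    intro j hj
    obtain ⟨s, c, hs, hsum⟩ := hexp j
    choose! ℓ d hℓ hd using fun k (hk : k ∈ s) =>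
      exists_hartley_slice_eq ha hab ((hs k hk).trans_le (hle j hj))
    refine ⟨∑ k ∈ s, c k • ℓ k, ∑ k ∈ s, c k * d k, fun hjK => ?_, fun θ => ?_⟩
    · refine Finset.sum_eq_zero fun k hk => ?_
      rw [hℓ k hk ((hs k hk).trans_lt ((hlt j).2 hjK)), smul_zero]
    · rw [hsum, LinearMap.sum_apply, ← Finset.sum_add_distrib]
      refine Finset.sum_congr rfl fun k hk => ?_
      rw [hd k hk θ, LinearMap.smul_apply, smul_eq_mul, mul_add]
  choose! ℓ c hℓ hval using hslice
  -- Only the indices from `2K + 1` to `d - 1` carry nonconstant functions: `2N + 1` functionals on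
  -- a real space of dimension `2N + 2`.
  let M : (Fin (N + 1) → ℂ) →ₗ[ℝ] (Fin (2 * N + 1) → ℝ) :=
    LinearMap.pi fun r => ℓ (2 * K + 1 + r)
  have hker : LinearMap.ker M ≠ ⊥ := by
    refine LinearMap.ker_ne_bot_of_finrank_lt ?_
    simp only [Module.finrank_pi_fintype, Complex.finrank_real_complex, Module.finrank_self]
    simp
    omega
  obtain ⟨w, hw, hw0⟩ := Submodule.exists_mem_ne_zero_of_ne_bot hker
  have hnorm : 0 < ‖w‖ := norm_pos_iff.2 hw0
  set u := ‖w‖⁻¹ • w with hu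
  have hu0 : u ≠ 0 := smul_ne_zero (inv_ne_zero hnorm.ne') hw0
  have hMu : M u = 0 := by rw [hu, map_smul, LinearMap.mem_ker.1 hw, smul_zero]
  have hunorm : ∀ i, ‖u i‖ ≤ 2 := by
    intro i
    refine (norm_le_pi_norm u i).trans ?_
    rw [hu, norm_smul, norm_inv, norm_norm, inv_mul_cancel₀ hnorm.ne']
    norm_num
  choose θ θ' hθ using fun i => exists_exp_sub_exp_eq (hunorm i)
  have hℓu : ∀ j, j < 2 * (K + 1 + N) → ℓ j u = 0 := by
    intro j hj
    by_cases hjK : j < 2 * K + 1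
    · rw [hℓ j hj.le hjK, LinearMap.zero_apply]
    · have h := congrFun hMu ⟨j - (2 * K + 1), by omega⟩
      have hidx : 2 * K + 1 + (j - (2 * K + 1)) = j := by omega
      simpa [M, hidx] using h
  have hueq : u = (fun i => Complex.exp (θ i * Complex.I))
      - fun i => Complex.exp (θ' i * Complex.I) := funext fun i => (hθ i).symm
  have heq : eigenMap φ m (proj _ (slice a θ)) = eigenMap φ m (proj _ (slice a θ')) := by
    ext i
    have hi : (i : ℕ) + 1 < 2 * (K + 1 + N) := by omega
    change φ (i + 1) _ = φ (i + 1) _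
    rw [hval _ hi.le, hval _ hi.le]
    have h := hℓu _ hi
    rw [hueq, map_sub, sub_eq_zero] at h
    rw [h]
  refine hu0 (funext fun i => ?_)
  rw [← hθ i, exp_eq_of_proj_slice_eq ha hab (hinj heq) i, sub_self]
  rfl

end Slice

theorem isEmbeddingDimension_stretched {N : ℕ} {a b : ℝ} (ha : 0 < a) (hab : a < b) {K : ℕ}
    (hK : (⌈b / a⌉ : ℤ) = K + 1) :
    IsEmbeddingDimension (stretchedSides (N + 2) a b) (2 * (K + 1 + N)) :=
  ⟨exists_embedding_eigenbasis ha hab hK, fun _ ⟨_, hφ, hF⟩ =>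
    le_of_injective_eigenMap ha hab hK hφ hF.embedding.injective⟩

end FlatTorus

/-! ### Injectivity radius. -/

namespace FlatTorus

section InjectivityRadius

variable {n : ℕ} {L : Fin n → ℝ}

/-- The quotient norm is an infimum over lifts, so a norm below `r` is witnessed by a lift of norm
below `r`. -/
theorem mem_ball_iff (x y : Torus L) (r : ℝ) :
    y ∈ Metric.ball x r ↔ ∃ v ∈ Metric.ball (0 : EuclideanSpace ℝ (Fin n)) r, expMap x v = y := by
  rw [mem_ball_iff_norm, QuotientAddGroup.norm_lt_iff]
  constructor
  · rintro ⟨v, hv, hvr⟩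
    refine ⟨v, mem_ball_zero_iff.2 hvr, ?_⟩
    change x + (v : Torus L) = y
    rw [hv, add_sub_cancel]
  · rintro ⟨v, hv, rfl⟩
    exact ⟨v, (add_sub_cancel_left x (proj L v)).symm, mem_ball_zero_iff.1 hv⟩

/-- Distinct points closer than every side length have distinct projections. -/
theorem injOn_expMap {ρ : ℝ} (hρ : ∀ j, 2 * ρ ≤ L j) (hL : ∀ j, 0 < L j) {r : ℝ} (hr : r ≤ ρ)
    (x : Torus L) : InjOn (expMap x) (Metric.ball 0 r) := by
  intro v hv w hw hvw
  have hproj : proj L v = proj L w := add_left_cancel (a := x) hvw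
  rw [proj_eq_proj_iff] at hproj
  ext j
  obtain ⟨k, hk⟩ := hproj j
  -- The difference is shorter than `2r ≤ L j`, which leaves zero as the only possible multiple of
  -- `L j`.
  have h1 : |w j - v j| < L j := by
    have h2 : ‖(w - v) j‖ ≤ ‖w - v‖ := PiLp.norm_apply_le (w - v) j
    have h3 := norm_sub_le w v
    rw [mem_ball_zero_iff] at hv hw
    have := hρ j
    have h4 : ‖(w - v) j‖ = |w j - v j| := by simp
    linarith
  rw [hk, abs_mul, abs_of_pos (hL j)] at h1
  have h5 : |(k : ℝ)| < 1 := by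
    by_contra! hcon
    nlinarith [hL j]
  have h6 : k = 0 := Int.abs_lt_one_iff.1 (by exact_mod_cast h5)
  rw [h6] at hk
  simp only [Int.cast_zero, zero_mul] at hk
  linarith

theorem isExpDiffeo_of_le {ρ : ℝ} (hρ : ∀ j, 2 * ρ ≤ L j) (hL : ∀ j, 0 < L j) {r : ℝ}
    (hr : r ≤ ρ) (x : Torus L) : IsExpDiffeo x r := by
  have hinj := injOn_expMap hρ hL hr x
  have hbij : BijOn (expMap x) (Metric.ball 0 r) (Metric.ball x r) :=
    ⟨fun v hv => (mem_ball_iff x _ r).2 ⟨v, hv, rfl⟩, hinj, fun y hy => (mem_ball_iff x y r).1 hy⟩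
  obtain ⟨u, rfl⟩ := proj_surjective x
  refine ⟨hbij, fun v _ => ⟨fun w => u + w, contDiffAt_const.add contDiffAt_id,
    Filter.Eventually.of_forall fun w => rfl⟩, ?_⟩
  let g := Function.invFunOn (expMap (proj L u)) (Metric.ball 0 r)
  have hg : InvOn g (expMap (proj L u)) (Metric.ball 0 r) (Metric.ball (proj L u) r) :=
    hbij.invOn_invFunOn
  refine ⟨g, hg, fun z hz => ?_⟩
  set v := g (proj L z) with hv
  have hvball : v ∈ Metric.ball (0 : EuclideanSpace ℝ (Fin n)) r :=
    Function.invFunOn_mem ((mem_ball_iff _ _ r).1 hz)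
  have hvz : expMap (proj L u) v = proj L z := hg.2 hz
  have hnear : ∀ᶠ z' in 𝓝 z, z' + (v - z) ∈ Metric.ball (0 : EuclideanSpace ℝ (Fin n)) r := by
    have hc : Continuous fun z' : EuclideanSpace ℝ (Fin n) => z' + (v - z) := by fun_prop
    refine hc.continuousAt.preimage_mem_nhds (Metric.isOpen_ball.mem_nhds ?_)
    simpa using hvball
  -- Near `z` the lifted inverse is a translation: the translated point stays in the ball and has
  -- the right image, and injectivity identifies it with the value of `g`.
  have hev : (g ∘ proj L) =ᶠ[𝓝 z] fun z' => z' + (v - z) := by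
    filter_upwards [hnear] with z' hz'
    have h1 : expMap (proj L u) (z' + (v - z)) = proj L z' := by
      have h2 : expMap (proj L u) (z' + (v - z)) = expMap (proj L u) v + proj L (z' - z) := by
        change proj L u + proj L (z' + (v - z)) = proj L u + proj L v + proj L (z' - z)
        rw [add_assoc]
        congr 1
        change _ = proj L (v + (z' - z))
        congr 1
        abel
      rw [h2, hvz]
      change proj L (z + (z' - z)) = proj L z'
      rw [add_sub_cancel]
    have h3 := hg.1 hz'
    rw [h1] at h3
    exact h3
  have hsm : ContDiffAt ℝ ∞ (fun z' : EuclideanSpace ℝ (Fin n) => z' + (v - z)) z :=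
    contDiffAt_id.add contDiffAt_const
  exact (hsm.congr_of_eventuallyEq hev).contDiffWithinAt

/-- The injectivity radius of a rectangular flat torus is half its shortest side. -/
theorem isInjectivityRadius_half (hL : ∀ j, 0 < L j) (i : Fin n) (hi : ∀ j, L i ≤ L j) :
    IsInjectivityRadius L (L i / 2) := by
  refine ⟨fun x r hr => isExpDiffeo_of_le (fun j => by linarith [hi j]) hL hr x, ?_⟩
  intro R hR
  by_contra! hlt
  have hinj := (hR 0 R le_rfl).1.injOn
  -- Beyond half the side, the ball contains both `±L i / 2` on the `i`-th axis, which the lattice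
  -- identifies.
  have hmem : ∀ s : ℝ, |s| = L i / 2 →
      EuclideanSpace.single i s ∈ Metric.ball (0 : EuclideanSpace ℝ (Fin n)) R := by
    intro s hs
    rw [mem_ball_zero_iff, PiLp.norm_single, Real.norm_eq_abs, hs]
    exact hlt
  have hpos := hL i
  have h1 := hmem (L i / 2) (abs_of_pos (by linarith))
  have h2 := hmem (-(L i / 2)) (by rw [abs_neg, abs_of_pos (by linarith)])
  have heq : proj L (EuclideanSpace.single i (L i / 2))
      = proj L (EuclideanSpace.single i (-(L i / 2))) := by
    rw [proj_eq_proj_iff]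
    intro j
    by_cases hj : j = i
    · subst hj
      refine ⟨-1, ?_⟩
      simp
      ring
    · exact ⟨0, by simp [hj]⟩
  have h3 := hinj h1 h2 (congrArg (fun y => (0 : Torus L) + y) heq)
  have h4 := congrArg (fun v : EuclideanSpace ℝ (Fin n) => v i) h3
  simp at h4
  linarith

end InjectivityRadius

end FlatTorus

/-! ### Assembly and the volume bound. -/

theorem mainTheorem4 (n : ℕ) (hn : 2 ≤ n) (a b : ℝ) (ha : 0 < a) (hab : a < b) :
    ∃ (d : ℕ) (ρ : ℝ),
      FlatTorus.IsEmbeddingDimension (FlatTorus.stretchedSides n a b) d ∧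
      FlatTorus.IsInjectivityRadius (FlatTorus.stretchedSides n a b) ρ ∧
      ρ = a / 2 ∧
      FlatTorus.totalVolume (FlatTorus.stretchedSides n a b) = a ^ (n - 1) * b ∧
      (d : ℤ) = 2 * (⌈b / a⌉ + (n : ℤ) - 2) ∧
      (2 : ℝ) ^ (1 - (n : ℤ)) * FlatTorus.totalVolume (FlatTorus.stretchedSides n a b) / ρ ^ n
        ≤ (d : ℝ) := by
  obtain ⟨N, rfl⟩ : ∃ N, n = N + 2 := ⟨n - 2, by omega⟩
  have hb : 0 < b := ha.trans hab
  have hceil : 1 < ⌈b / a⌉ := Int.lt_ceil.2 (by simpa using (one_lt_div ha).2 hab)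
  obtain ⟨K, hK⟩ : ∃ K : ℕ, (⌈b / a⌉ : ℤ) = K + 1 :=
    ⟨(⌈b / a⌉ - 1).toNat, by omega⟩
  have hL := FlatTorus.stretchedSides_pos (N := N) ha hab
  have hvol : FlatTorus.totalVolume (FlatTorus.stretchedSides (N + 2) a b)
      = a ^ (N + 2 - 1) * b := by
    rw [FlatTorus.totalVolume_eq hL, Fin.prod_univ_castSucc, FlatTorus.stretchedSides_last]
    simp [FlatTorus.stretchedSides_castSucc]
  have hinj := FlatTorus.isInjectivityRadius_half hL (Fin.castSucc (0 : Fin (N + 1))) fun j => by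
    rw [FlatTorus.stretchedSides_castSucc, FlatTorus.stretchedSides]
    split_ifs
    · exact hab.le
    · exact le_rfl
  rw [FlatTorus.stretchedSides_castSucc] at hinj
  refine ⟨2 * (K + 1 + N), a / 2, FlatTorus.isEmbeddingDimension_stretched ha hab hK, hinj, rfl,
    hvol, by push_cast; omega, ?_⟩
  rw [hvol]
  -- The powers of `2` leave a single factor `2` and those of `a` leave `1 / a`, so `b / a ≤ ⌈b / a⌉
  -- = K + 1` finishes the bound.
  have hratio : (2 : ℝ) ^ (1 - ((N + 2 : ℕ) : ℤ)) * (a ^ (N + 2 - 1) * b) / (a / 2) ^ (N + 2)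
      = 2 * (b / a) := by
    have h2 : (2 : ℝ) ^ (1 - ((N + 2 : ℕ) : ℤ)) = 2 / 2 ^ (N + 2) := by
      rw [zpow_sub₀ two_ne_zero, zpow_one, zpow_natCast]
    rw [h2, show N + 2 - 1 = N + 1 from rfl, div_pow, pow_succ a (N + 1)]
    field_simp
  rw [hratio]
  have h3 : b / a ≤ (K : ℝ) + 1 := by
    have := Int.le_ceil (b / a)
    rw [hK] at this
    exact_mod_cast this
  push_cast
  have : (0 : ℝ) ≤ N := Nat.cast_nonneg N
  linarith
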